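/- Let $\mathcal O\subset\mathbb R^d$ be a bounded open set, $H=L^2(\mathcal O)$, and let $A$ be the Dirichlet Laplacian in $H$, with a complete orthonormal system of eigenfunctions $e_k\in H^1_0(\mathcal O)$, $Ae_k=-\alpha_k e_k$, $0<\alpha_1\le\alpha_2\le\cdots$. Let $H^{-1}$ be the completion of $H$ for the norm $|v|_{H^{-1}}^2=\sum_k\alpha_k^{-1}\langle v,e_k\rangle^2$, and let $\mathcal H=H\times H^{-1}$. Let $Q\in\mathcal L(H)$ satisfy $Qe_k=\lambda_ke_k$ with $\sum_k\lambda_k^2/\alpha_k<\infty$. Let $F:H\to\mathbb R$ be of class $C^1$ with $F(0)=0$, $F\ge 0$, $\langle DF(x),x\rangle\ge0$ for all $x$, and $DF$ Lipschitz continuous. Fix $\mu>0$. Let $S_\mu(t)$ be the semigroup on $\mathcal H$ generated by $A_\mu(u,v)=(v,\tfrac1\mu Au-\tfrac1\mu v)$, let $Q_\mu\psi=\tfrac1\mu(0,Q\psi)$ for $\psi \in H$, and let $$C_\mu(u,v)=\tfrac12\Big((-A)^{-1}Q^2u,\ \tfrac1\mu(-A)^{-1}Q^2v\Big),\qquad (u,v)\in\mathcal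 H,$$ be the covariance operator of the linear system. Let $C_\mu^{-1/2}$ be the (pseudo-)inverse of $C_\mu^{1/2}$, with domain $D(C_\mu^{-1/2})=\mathrm{Im}\,C_\mu^{1/2}$, and set $|C_\mu^{-1/2}z|_{\mathcal H}=+\infty$ outside this domain. For $t_1<t_2$ and $z\in C([t_1,t_2];\mathcal H)$ let $$I^\mu_{t_1,t_2}(z)=\tfrac12\inf|\psi|^2_{L^2((t_1,t_2);H)}$$ (with $\inf\emptyset=+\infty$), the infimum being over all $\psi\in L^2((t_1,t_2);H)$ such that, for some $z_0\in\mathcal H$ and all $t\in[t_1,t_2]$, $$z(t)=S_\mu(t-t_1)z_0-\int_{t_1}^tS_\mu(t-s)Q_\mu Q\,DF(\Pi_1z(s))\,ds+\int_{t_1}^tS_\mu(t-s)Q_\mu\psi(s)\,ds,$$ where $\Pi_1(u,v)=u$. For $z \in C((-\infty,0];\mathcal H)$ let $I^\mu_{-\infty}(z)=\sup_{t<0}I^\mu_{t,0}(z)$, and let $$V^\mu(x,y)=\inf\{I^\mu_{0,T}(z):\ T>0,\ z\in C([0,T];\mathcal H),\ z(0)=0,\ z(T)=(x,y)\}$$ be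 the quasi-potential of the damped semilinear wave equation $\mu\,\partial_t^2u=\Delta u-\partial_tu-Q^2DF(u)+\sqrt\epsilon\,\partial_tw^Q$ with Dirichlet boundary conditions. Then, for every $(x,y)\in\mathcal H$, $$V^\mu(x,y)=\inf\Big\{I^\mu_{-\infty}(z):\ z\in C((-\infty,0];\mathcal H),\ z(0)=(x,y),\ \lim_{t\to-\infty}|C_\mu^{-1/2}z(t)|_{\mathcal H}=0\Big\}.$$ Moreover, with $L^\mu_{t_1,t_2}:L^2((t_1,t_2);H)\to\mathcal H$, $L^\mu_{t_1,t_2}\psi=\int_{t_1}^{t_2}S_\mu(t_2-s)Q_\mu\psi(s)\,ds$, there are $T_\mu>0$ and constants $c(\mu,\tau)<\infty$ such that for all $t_1<t_2-T_\mu$ we have $\mathrm{Im}(L^\mu_{t_1,t_2})=D(C_\mu^{-1/2})$ and, for every $z$ in this image, $$\inf\big\{|\psi|_{L^2((t_1,t_2);H)}:\ L^\mu_{t_1,t_2}\psi=z\big\}\le c(\mu,t_2-t_1)\,|C_\mu^{-1/2}z|_{\mathcal H}.$$ -/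

import Mathlib

open MeasureTheory Filter Topology
open scoped ENNReal NNReal lp ContDiff

noncomputable section

namespace DampedWave

/-! ### The Dirichlet Laplacian on a domain -/

/-- The real Hilbert space `L²(O)`, with Lebesgue measure on `O ⊆ ℝ^d`. -/
abbrev L2 {d : ℕ} (O : Set (EuclideanSpace ℝ (Fin d))) : Type :=
  Lp ℝ 2 (volume.restrict O)

/-- Test functions: the elements of `C_c^∞(O)`. -/
def IsTestFunction {d : ℕ} (O : Set (EuclideanSpace ℝ (Fin d)))
    (φ : EuclideanSpace ℝ (Fin d) → ℝ) : Prop :=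
  ContDiff ℝ ∞ φ ∧ HasCompactSupport φ ∧ tsupport φ ⊆ O

/-- `u` belongs to `H^1_0(O)`, the closure of `C_c^∞(O)` in `H^1(O)`, and its weak gradient
is `G`. -/
def HasH10Gradient {d : ℕ} (O : Set (EuclideanSpace ℝ (Fin d)))
    (u : L2 O) (G : EuclideanSpace ℝ (Fin d) → EuclideanSpace ℝ (Fin d)) : Prop :=
  MemLp G 2 (volume.restrict O) ∧
  ∃ φ : ℕ → EuclideanSpace ℝ (Fin d) → ℝ, (∀ n, IsTestFunction O (φ n)) ∧
    Tendsto (fun n => eLpNorm (fun ξ => φ n ξ - u ξ) 2 (volume.restrict O)) atTop (𝓝 0) ∧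
    Tendsto (fun n => eLpNorm (fun ξ => gradient (φ n) ξ - G ξ) 2 (volume.restrict O))
      atTop (𝓝 0)

/-- `u` lies in the domain of the Dirichlet Laplacian `A` of `O` and `A u = -a u`:
`u ∈ H^1_0(O)` and `∫_O ∇u · ∇φ = a ∫_O u φ` for all test functions `φ`. -/
def IsDirichletEigenfunction {d : ℕ} (O : Set (EuclideanSpace ℝ (Fin d)))
    (a : ℝ) (u : L2 O) : Prop :=
  ∃ G, HasH10Gradient O u G ∧ ∀ φ, IsTestFunction O φ →
    ∫ ξ in O, inner ℝ (G ξ) (gradient φ ξ) = a * ∫ ξ in O, u ξ * φ ξ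

/-! ### Spectral data and the phase space -/

variable {H : Type*} [NormedAddCommGroup H] [InnerProductSpace ℝ H]

/-- A complete orthonormal system `e` of `H` with a sequence `0 < α 0 ≤ α 1 ≤ …`. It encodes the
operator `A` with `A (e k) = - α k • e k`. -/
structure SpectralBasis (H : Type*) [NormedAddCommGroup H] [InnerProductSpace ℝ H] where
  e : HilbertBasis ℕ ℝ H
  α : ℕ → ℝ
  α_zero_pos : 0 < α 0
  α_mono : Monotone α

theorem SpectralBasis.α_pos (D : SpectralBasis H) (k : ℕ) : 0 < D.α k :=
  D.α_zero_pos.trans_le (D.α_mono (Nat.zero_le k))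

/-- The sequences `v` of Fourier coefficients with `∑ α_k⁻¹ v_k² < ∞`. -/
def negSubmodule (D : SpectralBasis H) : Submodule ℝ (ℕ → ℝ) where
  carrier := {v | Summable fun k => (D.α k)⁻¹ * v k ^ 2}
  zero_mem' := by simp
  add_mem' := by
    intro a b ha hb
    refine Summable.of_nonneg_of_le (fun k => ?_) (fun k => ?_)
      ((ha.mul_left 2).add (hb.mul_left 2))
    · exact mul_nonneg (inv_nonneg.2 (D.α_pos k).le) (sq_nonneg _)
    · have := inv_nonneg.2 (D.α_pos k).le
      simp only [Pi.add_apply]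
      nlinarith [mul_nonneg this (sq_nonneg (a k - b k))]
  smul_mem' := by
    intro c a ha
    refine (ha.mul_left (c ^ 2)).congr (fun k => ?_)
    simp only [Pi.smul_apply, smul_eq_mul]
    ring

/-- The space `H^{-1}`, the completion of `H` for the norm `(∑ α_k⁻¹ ⟨v, e_k⟩²)^{1/2}`, realized by
Fourier coefficients. -/
def HMinusOne (D : SpectralBasis H) : Type := ↥(negSubmodule D)

instance (D : SpectralBasis H) : AddCommGroup (HMinusOne D) :=
  inferInstanceAs (AddCommGroup ↥(negSubmodule D))

instance (D : SpectralBasis H) : Module ℝ (HMinusOne D) :=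
  inferInstanceAs (Module ℝ ↥(negSubmodule D))

/-- The `k`-th Fourier coefficient of an element of `H^{-1}`. -/
def HMinusOne.coeff {D : SpectralBasis H} (v : HMinusOne D) (k : ℕ) : ℝ := Subtype.val v k

/-- The `k`-th Fourier coefficient `⟨u, e_k⟩` of an element of `H`. -/
def SpectralBasis.coeff (D : SpectralBasis H) (u : H) (k : ℕ) : ℝ := inner ℝ (D.e k) u

theorem SpectralBasis.coeff_eq (D : SpectralBasis H) (u : H) (k : ℕ) :
    D.coeff u k = D.e.repr u k := (D.e.repr_apply_apply u k).symm

/-- The identification `v ↦ (α_k^{-1/2} v_k)_k` of `H^{-1}` with `ℓ²`. -/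
def negEquiv (D : SpectralBasis H) : HMinusOne D ≃ₗ[ℝ] ℓ²(ℕ, ℝ) where
  toFun v := ⟨fun k => (√(D.α k))⁻¹ * v.coeff k, by
    refine memℓp_gen ?_
    refine (Subtype.property v : Summable fun k => (D.α k)⁻¹ * v.coeff k ^ 2).congr fun k => ?_
    simp only [ENNReal.toReal_ofNat, Real.rpow_ofNat, Real.norm_eq_abs, sq_abs, mul_pow, inv_pow,
      Real.sq_sqrt (D.α_pos k).le]
    rfl⟩
  map_add' v w := by
    ext k
    exact mul_add _ (v.coeff k) (w.coeff k)
  map_smul' c v := by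
    ext k
    exact mul_left_comm _ c (v.coeff k)
  invFun f := ⟨fun k => √(D.α k) * f k, by
    have h := (memℓp_gen_iff (p := 2) (by simp)).1 (lp.memℓp f)
    refine h.congr fun k => ?_
    have := D.α_pos k
    simp only [mul_pow, Real.sq_sqrt this.le, ENNReal.toReal_ofNat, Real.rpow_ofNat, Real.norm_eq_abs,
      sq_abs]
    field_simp⟩
  left_inv v := by
    apply Subtype.ext
    funext k
    have : √(D.α k) ≠ 0 := (Real.sqrt_pos.2 (D.α_pos k)).ne'
    exact mul_inv_cancel_left₀ this (v.coeff k)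
  right_inv f := by
    ext k
    have : √(D.α k) ≠ 0 := (Real.sqrt_pos.2 (D.α_pos k)).ne'
    exact inv_mul_cancel_left₀ this (f k)

instance (D : SpectralBasis H) : NormedAddCommGroup (HMinusOne D) :=
  NormedAddCommGroup.induced _ _ (negEquiv D).toLinearMap (negEquiv D).injective

instance (D : SpectralBasis H) : NormedSpace ℝ (HMinusOne D) :=
  NormedSpace.induced ℝ (HMinusOne D) ℓ²(ℕ, ℝ) (negEquiv D).toLinearMap

/-- The identification of `H^{-1}` with `ℓ²` is isometric. -/
def negIso (D : SpectralBasis H) : HMinusOne D ≃ₗᵢ[ℝ] ℓ²(ℕ, ℝ) :=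
  ⟨negEquiv D, fun _ => rfl⟩

instance (D : SpectralBasis H) : CompleteSpace (HMinusOne D) :=
  (negIso D).toIsometryEquiv.completeSpace

/-- The norm of `H^{-1}` is the expected one. -/
theorem HMinusOne.norm_sq {D : SpectralBasis H} (v : HMinusOne D) :
    ‖v‖ ^ 2 = ∑' k, (D.α k)⁻¹ * v.coeff k ^ 2 := by
  have h := lp.norm_rpow_eq_tsum (p := 2) (by simp) (negIso D v)
  rw [(negIso D).norm_map] at h
  simp only [ENNReal.toReal_ofNat, Real.rpow_ofNat] at h
  rw [h]
  refine tsum_congr fun k => ?_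
  change ‖(√(D.α k))⁻¹ * v.coeff k‖ ^ 2 = _
  simp [mul_pow, inv_pow, Real.sq_sqrt (D.α_pos k).le]

/-- The phase space `𝓗 = H × H^{-1}`, with its Hilbert norm `(|u|_H² + |v|_{H^{-1}}²)^{1/2}`. -/
abbrev Phase (D : SpectralBasis H) : Type _ := WithLp 2 (H × HMinusOne D)

/-! ### Fourier multipliers -/

/-- The bounded multiplication operator `(f_k) ↦ (m_k f_k)` on `ℓ²`. -/
def mulL2 (m : ℕ → ℝ) (hm : ∃ K, ∀ k, |m k| ≤ K) : ℓ²(ℕ, ℝ) →L[ℝ] ℓ²(ℕ, ℝ) :=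
  lp.mapCLM 2 (fun k => m k • ContinuousLinearMap.id ℝ ℝ)
    (K := hm.choose) ((abs_nonneg (m 0)).trans (hm.choose_spec 0)) (fun k => by
      simpa [norm_smul] using hm.choose_spec k)

theorem mulL2_apply (m : ℕ → ℝ) (hm : ∃ K, ∀ k, |m k| ≤ K) (f : ℓ²(ℕ, ℝ)) (k : ℕ) :
    mulL2 m hm f k = m k * f k := by
  simp [mulL2]

/-- Multiplier `H → H`. -/
def mulHH (D : SpectralBasis H) (m : ℕ → ℝ) (hm : ∃ K, ∀ k, |m k| ≤ K) : H →L[ℝ] H :=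
  D.e.repr.symm.toContinuousLinearEquiv.toContinuousLinearMap ∘L mulL2 m hm ∘L
    D.e.repr.toContinuousLinearEquiv.toContinuousLinearMap

/-- Multiplier `H → H^{-1}`. -/
def mulHN (D : SpectralBasis H) (m : ℕ → ℝ) (hm : ∃ K, ∀ k, |(√(D.α k))⁻¹ * m k| ≤ K) :
    H →L[ℝ] HMinusOne D :=
  (negIso D).symm.toContinuousLinearEquiv.toContinuousLinearMap ∘L
    mulL2 (fun k => (√(D.α k))⁻¹ * m k) hm ∘L
    D.e.repr.toContinuousLinearEquiv.toContinuousLinearMap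

/-- Multiplier `H^{-1} → H`. -/
def mulNH (D : SpectralBasis H) (m : ℕ → ℝ) (hm : ∃ K, ∀ k, |m k * √(D.α k)| ≤ K) :
    HMinusOne D →L[ℝ] H :=
  D.e.repr.symm.toContinuousLinearEquiv.toContinuousLinearMap ∘L
    mulL2 (fun k => m k * √(D.α k)) hm ∘L
    (negIso D).toContinuousLinearEquiv.toContinuousLinearMap

/-- Multiplier `H^{-1} → H^{-1}`. -/
def mulNN (D : SpectralBasis H) (m : ℕ → ℝ) (hm : ∃ K, ∀ k, |m k| ≤ K) :
    HMinusOne D →L[ℝ] HMinusOne D :=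
  (negIso D).symm.toContinuousLinearEquiv.toContinuousLinearMap ∘L mulL2 m hm ∘L
    (negIso D).toContinuousLinearEquiv.toContinuousLinearMap

theorem negIso_symm_coeff (D : SpectralBasis H) (f : ℓ²(ℕ, ℝ)) (k : ℕ) :
    ((negIso D).symm f).coeff k = √(D.α k) * f k := rfl

theorem negIso_apply (D : SpectralBasis H) (v : HMinusOne D) (k : ℕ) :
    negIso D v k = (√(D.α k))⁻¹ * v.coeff k := rfl

theorem coeff_mulHH (D : SpectralBasis H) (m : ℕ → ℝ) (hm) (u : H) (k : ℕ) :
    D.coeff (mulHH D m hm u) k = m k * D.coeff u k := by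
  simp [mulHH, SpectralBasis.coeff_eq, mulL2_apply]

theorem coeff_mulHN (D : SpectralBasis H) (m : ℕ → ℝ) (hm) (u : H) (k : ℕ) :
    (mulHN D m hm u).coeff k = m k * D.coeff u k := by
  have : √(D.α k) ≠ 0 := (Real.sqrt_pos.2 (D.α_pos k)).ne'
  simp only [mulHN, SpectralBasis.coeff_eq, ContinuousLinearMap.comp_apply,
    ContinuousLinearEquiv.coe_coe, LinearIsometryEquiv.coe_toContinuousLinearEquiv,
    negIso_symm_coeff, mulL2_apply]
  field_simp

theorem coeff_mulNH (D : SpectralBasis H) (m : ℕ → ℝ) (hm) (v : HMinusOne D) (k : ℕ) :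
    D.coeff (mulNH D m hm v) k = m k * v.coeff k := by
  have : √(D.α k) ≠ 0 := (Real.sqrt_pos.2 (D.α_pos k)).ne'
  simp only [mulNH, SpectralBasis.coeff_eq, ContinuousLinearMap.comp_apply,
    ContinuousLinearEquiv.coe_coe, LinearIsometryEquiv.coe_toContinuousLinearEquiv,
    LinearIsometryEquiv.apply_symm_apply, negIso_apply, mulL2_apply]
  field_simp

theorem coeff_mulNN (D : SpectralBasis H) (m : ℕ → ℝ) (hm) (v : HMinusOne D) (k : ℕ) :
    (mulNN D m hm v).coeff k = m k * v.coeff k := by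
  have : √(D.α k) ≠ 0 := (Real.sqrt_pos.2 (D.α_pos k)).ne'
  simp only [mulNN, ContinuousLinearMap.comp_apply,
    ContinuousLinearEquiv.coe_coe, LinearIsometryEquiv.coe_toContinuousLinearEquiv,
    negIso_symm_coeff, negIso_apply, mulL2_apply]
  field_simp

/-- The operator on `𝓗` given by a `2 × 2` block of operators. -/
def blockOp (D : SpectralBasis H) (a : H →L[ℝ] H) (b : HMinusOne D →L[ℝ] H)
    (c : H →L[ℝ] HMinusOne D) (d : HMinusOne D →L[ℝ] HMinusOne D) :
    Phase D →L[ℝ] Phase D :=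
  (WithLp.prodContinuousLinearEquiv 2 ℝ H (HMinusOne D)).symm.toContinuousLinearMap ∘L
    ((a.coprod b).prod (c.coprod d)) ∘L
    (WithLp.prodContinuousLinearEquiv 2 ℝ H (HMinusOne D)).toContinuousLinearMap

theorem blockOp_apply (D : SpectralBasis H) (a : H →L[ℝ] H) (b : HMinusOne D →L[ℝ] H)
    (c : H →L[ℝ] HMinusOne D) (d : HMinusOne D →L[ℝ] HMinusOne D) (z : Phase D) :
    blockOp D a b c d z =
      WithLp.toLp 2 (a z.fst + b z.snd, c z.fst + d z.snd) := rfl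

theorem exists_bound_inv_sqrt (D : SpectralBasis H) : ∀ k, (√(D.α k))⁻¹ ≤ (√(D.α 0))⁻¹ := fun k =>
  inv_anti₀ (Real.sqrt_pos.2 D.α_zero_pos) (Real.sqrt_le_sqrt (D.α_mono (Nat.zero_le k)))

/-- The inclusion `H ⊆ H^{-1}` (it does not change Fourier coefficients). -/
def embed (D : SpectralBasis H) : H →L[ℝ] HMinusOne D :=
  mulHN D (fun _ => 1) ⟨(√(D.α 0))⁻¹, fun k => by
    rw [mul_one, abs_of_nonneg (by positivity)]
    exact exists_bound_inv_sqrt D k⟩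

/-! ### The semigroup of the linear damped wave equation -/

/-- The matrix of `A_μ (u, v) = (v, μ⁻¹ A u - μ⁻¹ v)` on an eigenspace where `A = -a`. -/
def modeMatrix (μ a : ℝ) : Matrix (Fin 2) (Fin 2) ℝ := !![0, 1; -a / μ, -1 / μ]

/-- The exponential `exp (t A_μ)` on an eigenspace where `A = -a`. -/
def modeFlow (μ a t : ℝ) : Matrix (Fin 2) (Fin 2) ℝ := NormedSpace.exp (t • modeMatrix μ a)

theorem modeFlow_zero (μ a : ℝ) : modeFlow μ a 0 = 1 := by
  simp [modeFlow]

open scoped Matrix.Norms.Operator in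
theorem hasDerivAt_modeFlow (μ a t : ℝ) (i j : Fin 2) :
    HasDerivAt (fun s => modeFlow μ a s i j) ((modeMatrix μ a * modeFlow μ a t) i j) t := by
  have h := hasDerivAt_exp_smul_const' (𝕂 := ℝ) (modeMatrix μ a) t
  exact hasDerivAt_pi.1 (hasDerivAt_pi.1 h i) j

/-- Energy bound for a single mode. -/
theorem modeFlow_energy {μ a : ℝ} (hμ : 0 < μ) (ha : 0 < a) (t : ℝ) (j : Fin 2) :
    a * modeFlow μ a t 0 j ^ 2 + μ * modeFlow μ a t 1 j ^ 2 ≤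
      Real.exp (2 / μ * |t|) * (a * (1 : Matrix (Fin 2) (Fin 2) ℝ) 0 j ^ 2 +
        μ * (1 : Matrix (Fin 2) (Fin 2) ℝ) 1 j ^ 2) := by
  set p : ℝ → ℝ := fun s => modeFlow μ a s 0 j with hp
  set q : ℝ → ℝ := fun s => modeFlow μ a s 1 j with hq
  have dp : ∀ s, HasDerivAt p (q s) s := fun s => by
    convert hasDerivAt_modeFlow μ a s 0 j using 1
    simp [Matrix.mul_apply, modeMatrix, hq]
  have dq : ∀ s, HasDerivAt q (-a / μ * p s + -1 / μ * q s) s := fun s => by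
    convert hasDerivAt_modeFlow μ a s 1 j using 1
    simp [Matrix.mul_apply, modeMatrix, hp, hq]
  set E : ℝ → ℝ := fun s => a * p s ^ 2 + μ * q s ^ 2 with hE
  have dE : ∀ s, HasDerivAt E (-2 * q s ^ 2) s := fun s => by
    have h := (((dp s).pow 2).const_mul a).add (((dq s).pow 2).const_mul μ)
    have h2 : a * (↑2 * p s ^ (2 - 1) * q s) +
        μ * (↑2 * q s ^ (2 - 1) * (-a / μ * p s + -1 / μ * q s)) = -2 * q s ^ 2 := by
      norm_num
      field_simp
      ring
    exact h2 ▸ h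
  have hE0 : E 0 = a * (1 : Matrix (Fin 2) (Fin 2) ℝ) 0 j ^ 2 +
      μ * (1 : Matrix (Fin 2) (Fin 2) ℝ) 1 j ^ 2 := by
    simp [hE, hp, hq, modeFlow_zero]
  rw [← hE0]
  change E t ≤ _
  have Enn : ∀ s, 0 ≤ E s := fun s => by positivity
  rcases le_total 0 t with ht | ht
  · have : Antitone E := antitone_of_hasDerivAt_nonpos dE fun s => by
      change -2 * q s ^ 2 ≤ 0
      nlinarith [sq_nonneg (q s)]
    refine (this ht).trans ?_
    have h1 : (1 : ℝ) ≤ Real.exp (2 / μ * |t|) := Real.one_le_exp (by positivity)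
    nlinarith [Enn 0]
  · have dG : ∀ s, HasDerivAt (fun s => Real.exp (2 / μ * s) * E s)
        (Real.exp (2 / μ * s) * (2 / μ * (a * p s ^ 2))) s := fun s => by
      have h1 : HasDerivAt (fun s : ℝ => Real.exp (2 / μ * s))
          (Real.exp (2 / μ * s) * (2 / μ)) s := by
        simpa using ((hasDerivAt_id s).const_mul (2 / μ)).exp
      have h3 : Real.exp (2 / μ * s) * (2 / μ) * E s + Real.exp (2 / μ * s) * (-2 * q s ^ 2) =
          Real.exp (2 / μ * s) * (2 / μ * (a * p s ^ 2)) := by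
        have : E s = a * p s ^ 2 + μ * q s ^ 2 := rfl
        rw [this]
        field_simp
        ring
      exact h3 ▸ h1.mul (dE s)
    have hm : Monotone (fun s => Real.exp (2 / μ * s) * E s) :=
      monotone_of_hasDerivAt_nonneg dG fun s => by positivity
    have h2 := hm ht
    simp only [mul_zero, Real.exp_zero, one_mul] at h2
    rw [abs_of_nonpos ht, mul_neg, Real.exp_neg, inv_mul_eq_div, le_div_iff₀ (Real.exp_pos _)]
    linarith

theorem modeFlow_bounds {μ a : ℝ} (hμ : 0 < μ) (ha : 0 < a) (t : ℝ) :
    |modeFlow μ a t 0 0| ≤ √(Real.exp (2 / μ * |t|)) ∧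
    |modeFlow μ a t 0 1 * √a| ≤ √(Real.exp (2 / μ * |t|) * μ) ∧
    |(√a)⁻¹ * modeFlow μ a t 1 0| ≤ √(Real.exp (2 / μ * |t|) / μ) ∧
    |modeFlow μ a t 1 1| ≤ √(Real.exp (2 / μ * |t|)) := by
  have h0 := modeFlow_energy hμ ha t 0
  have h1 := modeFlow_energy hμ ha t 1
  simp only [Matrix.one_apply_eq, ne_eq, one_ne_zero, not_false_eq_true, Matrix.one_apply_ne,
    zero_ne_one, one_pow, mul_one, OfNat.ofNat_ne_zero, zero_pow, mul_zero, add_zero,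
    zero_add] at h0 h1
  set K := Real.exp (2 / μ * |t|)
  refine ⟨Real.abs_le_sqrt ?_, Real.abs_le_sqrt ?_, Real.abs_le_sqrt ?_, Real.abs_le_sqrt ?_⟩
  · have : a * modeFlow μ a t 0 0 ^ 2 ≤ a * K := by
      nlinarith [mul_nonneg hμ.le (sq_nonneg (modeFlow μ a t 1 0))]
    exact le_of_mul_le_mul_left this ha
  · rw [mul_pow, Real.sq_sqrt ha.le]
    nlinarith [mul_nonneg hμ.le (sq_nonneg (modeFlow μ a t 1 1))]
  · rw [mul_pow, inv_pow, Real.sq_sqrt ha.le, inv_mul_eq_div, div_le_div_iff₀ ha hμ]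
    nlinarith [mul_nonneg ha.le (sq_nonneg (modeFlow μ a t 0 0))]
  · have : μ * modeFlow μ a t 1 1 ^ 2 ≤ μ * K := by
      nlinarith [mul_nonneg ha.le (sq_nonneg (modeFlow μ a t 0 1))]
    exact le_of_mul_le_mul_left this hμ

/-- The semigroup `S_μ(t) = exp (t A_μ)` on `𝓗` generated by
`A_μ (u, v) = (v, μ⁻¹ A u - μ⁻¹ v)`: on the `k`-th Fourier coefficients it acts by the matrix
exponential of `A_μ` there. -/
def S (D : SpectralBasis H) {μ : ℝ} (hμ : 0 < μ) (t : ℝ) : Phase D →L[ℝ] Phase D :=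
  blockOp D
    (mulHH D (fun k => modeFlow μ (D.α k) t 0 0)
      ⟨_, fun k => (modeFlow_bounds hμ (D.α_pos k) t).1⟩)
    (mulNH D (fun k => modeFlow μ (D.α k) t 0 1)
      ⟨_, fun k => (modeFlow_bounds hμ (D.α_pos k) t).2.1⟩)
    (mulHN D (fun k => modeFlow μ (D.α k) t 1 0)
      ⟨_, fun k => (modeFlow_bounds hμ (D.α_pos k) t).2.2.1⟩)
    (mulNN D (fun k => modeFlow μ (D.α k) t 1 1)
      ⟨_, fun k => (modeFlow_bounds hμ (D.α_pos k) t).2.2.2⟩)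

theorem coeff_S_fst (D : SpectralBasis H) {μ : ℝ} (hμ : 0 < μ) (t : ℝ) (z : Phase D) (k : ℕ) :
    D.coeff (S D hμ t z).fst k =
      modeFlow μ (D.α k) t 0 0 * D.coeff z.fst k + modeFlow μ (D.α k) t 0 1 * z.snd.coeff k := by
  rw [← coeff_mulHH D (fun k => modeFlow μ (D.α k) t 0 0)
      ⟨_, fun k => (modeFlow_bounds hμ (D.α_pos k) t).1⟩,
    ← coeff_mulNH D (fun k => modeFlow μ (D.α k) t 0 1)
      ⟨_, fun k => (modeFlow_bounds hμ (D.α_pos k) t).2.1⟩]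
  exact inner_add_right _ _ _

theorem coeff_S_snd (D : SpectralBasis H) {μ : ℝ} (hμ : 0 < μ) (t : ℝ) (z : Phase D) (k : ℕ) :
    (S D hμ t z).snd.coeff k =
      modeFlow μ (D.α k) t 1 0 * D.coeff z.fst k + modeFlow μ (D.α k) t 1 1 * z.snd.coeff k := by
  rw [← coeff_mulHN D (fun k => modeFlow μ (D.α k) t 1 0)
      ⟨_, fun k => (modeFlow_bounds hμ (D.α_pos k) t).2.2.1⟩,
    ← coeff_mulNN D (fun k => modeFlow μ (D.α k) t 1 1)
      ⟨_, fun k => (modeFlow_bounds hμ (D.α_pos k) t).2.2.2⟩]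
  rfl

/-! ### The noise operator and the covariance -/

/-- The noise operator: `Q` is bounded and diagonal, `Q (e k) = lam k • e k`, with
`∑ lam_k² / α_k < ∞`. -/
structure DiagonalNoise (D : SpectralBasis H) where
  Q : H →L[ℝ] H
  lam : ℕ → ℝ
  diagonal : ∀ k, Q (D.e k) = lam k • D.e k
  summable : Summable fun k => lam k ^ 2 / D.α k

theorem DiagonalNoise.abs_lam_le {D : SpectralBasis H} (N : DiagonalNoise D) (k : ℕ) :
    |N.lam k| ≤ ‖N.Q‖ := by
  have h := N.Q.le_opNorm (D.e k)
  rw [N.diagonal, norm_smul, D.e.orthonormal.1 k] at h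
  simpa using h

/-- `Q_μ ψ = μ⁻¹ (0, Q ψ)`. -/
def Qmu {D : SpectralBasis H} (N : DiagonalNoise D) (μ : ℝ) (ψ : H) : Phase D :=
  WithLp.toLp 2 (0, μ⁻¹ • embed D (N.Q ψ))

theorem cov_bound {D : SpectralBasis H} (N : DiagonalNoise D) {c : ℝ} (hc : 0 < c) (k : ℕ) :
    |1 / (c * D.α k) * N.lam k ^ 2| ≤ 1 / (c * D.α 0) * ‖N.Q‖ ^ 2 := by
  have h1 := D.α_mono (Nat.zero_le k)
  have h2 := D.α_zero_pos
  have h3 := N.abs_lam_le k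
  have h4 := D.α_pos k
  rw [abs_mul, abs_pow, abs_of_pos (by positivity)]
  gcongr

theorem covSqrt_bound {D : SpectralBasis H} (N : DiagonalNoise D) {c : ℝ} (hc : 0 < c) (k : ℕ) :
    abs (√(1 / (c * D.α k)) * |N.lam k|) ≤ √(1 / (c * D.α 0) * ‖N.Q‖ ^ 2) := by
  have h4 := D.α_pos k
  refine Real.abs_le_sqrt ?_
  rw [mul_pow, sq_abs, Real.sq_sqrt (by positivity)]
  exact (le_abs_self _).trans (cov_bound N hc k)

/-- The covariance operator `C_μ (u, v) = ½ ((-A)⁻¹ Q² u, μ⁻¹ (-A)⁻¹ Q² v)` on `𝓗`. -/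
def cov {D : SpectralBasis H} (N : DiagonalNoise D) {μ : ℝ} (hμ : 0 < μ) :
    Phase D →L[ℝ] Phase D :=
  blockOp D
    (mulHH D (fun k => 1 / (2 * D.α k) * N.lam k ^ 2) ⟨_, cov_bound N two_pos⟩) 0 0
    (mulNN D (fun k => 1 / (2 * μ * D.α k) * N.lam k ^ 2) ⟨_, cov_bound N (mul_pos two_pos hμ)⟩)

/-- The nonnegative square root `C_μ^{1/2}`. -/
def covSqrt {D : SpectralBasis H} (N : DiagonalNoise D) {μ : ℝ} (hμ : 0 < μ) :
    Phase D →L[ℝ] Phase D :=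
  blockOp D
    (mulHH D (fun k => √(1 / (2 * D.α k)) * |N.lam k|) ⟨_, covSqrt_bound N two_pos⟩) 0 0
    (mulNN D (fun k => √(1 / (2 * μ * D.α k)) * |N.lam k|) ⟨_, covSqrt_bound N (mul_pos two_pos hμ)⟩)

theorem HMinusOne.ext_coeff {D : SpectralBasis H} {v w : HMinusOne D}
    (h : ∀ k, v.coeff k = w.coeff k) : v = w := Subtype.ext (funext h)

theorem SpectralBasis.ext_coeff (D : SpectralBasis H) {u w : H}
    (h : ∀ k, D.coeff u k = D.coeff w k) : u = w := by
  apply D.e.repr.injective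
  ext k
  simpa [D.coeff_eq] using h k

/-- `covSqrt` squares to the covariance. -/
theorem covSqrt_covSqrt {D : SpectralBasis H} (N : DiagonalNoise D) {μ : ℝ} (hμ : 0 < μ)
    (z : Phase D) : covSqrt N hμ (covSqrt N hμ z) = cov N hμ z := by
  simp only [covSqrt, cov, blockOp_apply, _root_.zero_apply, add_zero, zero_add,
    WithLp.toLp_fst, WithLp.toLp_snd]
  congr 2
  · refine D.ext_coeff fun k => ?_
    have := D.α_pos k
    rw [coeff_mulHH, coeff_mulHH, coeff_mulHH, ← mul_assoc, mul_mul_mul_comm,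
      Real.mul_self_sqrt (by positivity), abs_mul_abs_self, sq]
  · refine HMinusOne.ext_coeff fun k => ?_
    have := D.α_pos k
    rw [coeff_mulNN, coeff_mulNN, coeff_mulNN, ← mul_assoc, mul_mul_mul_comm,
      Real.mul_self_sqrt (by positivity), abs_mul_abs_self, sq]

/-- `|C_μ^{-1/2} z|_𝓗`, where `C_μ^{-1/2}` is the (pseudo-)inverse of `C_μ^{1/2}`: the least norm of
a preimage of `z` under `C_μ^{1/2}`, and `∞` when `z` is not in `D(C_μ^{-1/2}) = Im C_μ^{1/2}`. -/
def covInvSqrtNorm {D : SpectralBasis H} (N : DiagonalNoise D) {μ : ℝ} (hμ : 0 < μ)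
    (z : Phase D) : ℝ≥0∞ :=
  ⨅ (w : Phase D) (_ : covSqrt N hμ w = z), ‖w‖ₑ

/-! ### Controlled paths, action and quasi-potential -/

/-- `L^μ_{t₁,t₂} ψ = ∫_{t₁}^{t₂} S_μ(t₂ - s) Q_μ ψ(s) ds`. -/
def controlMap {D : SpectralBasis H} (N : DiagonalNoise D) {μ : ℝ} (hμ : 0 < μ) (t₁ t₂ : ℝ)
    (ψ : ℝ → H) : Phase D :=
  ∫ s in t₁..t₂, S D hμ (t₂ - s) (Qmu N μ (ψ s))

/-- `|(L^μ_{t₁,t₂})⁻¹ z|_{L²((t₁,t₂);H)}` for the pseudo-inverse: the least norm of a control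
`ψ` with `L^μ_{t₁,t₂} ψ = z`. -/
def controlCost {D : SpectralBasis H} (N : DiagonalNoise D) {μ : ℝ} (hμ : 0 < μ) (t₁ t₂ : ℝ)
    (z : Phase D) : ℝ≥0∞ :=
  ⨅ (ψ : ℝ → H) (_ : MemLp ψ 2 (volume.restrict (Set.Ioo t₁ t₂)))
    (_ : controlMap N hμ t₁ t₂ ψ = z), eLpNorm ψ 2 (volume.restrict (Set.Ioo t₁ t₂))

variable [CompleteSpace H]

/-- The skeleton equation on `[t₁, t₂]` with initial datum `z₀` and control `ψ`:
`z(t) = S_μ(t-t₁) z₀ - ∫_{t₁}^t S_μ(t-s) Q_μ Q DF(Π₁ z(s)) ds + ∫_{t₁}^t S_μ(t-s) Q_μ ψ(s) ds`. -/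
def IsSkeleton {D : SpectralBasis H} (N : DiagonalNoise D) (F : H → ℝ) {μ : ℝ} (hμ : 0 < μ)
    (t₁ t₂ : ℝ) (z₀ : Phase D) (ψ : ℝ → H) (z : ℝ → Phase D) : Prop :=
  ∀ t ∈ Set.Icc t₁ t₂, z t = S D hμ (t - t₁) z₀
    - (∫ s in t₁..t, S D hμ (t - s) (Qmu N μ (N.Q (gradient F (z s).fst))))
    + ∫ s in t₁..t, S D hμ (t - s) (Qmu N μ (ψ s))

/-- The action `I^μ_{t₁,t₂}(z)`: half the least squared `L²((t₁,t₂);H)` norm of a control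
producing `z`; it is `∞` if there is none. -/
def action {D : SpectralBasis H} (N : DiagonalNoise D) (F : H → ℝ) {μ : ℝ} (hμ : 0 < μ)
    (t₁ t₂ : ℝ) (z : ℝ → Phase D) : ℝ≥0∞ :=
  (1 / 2) * ⨅ (ψ : ℝ → H) (_ : MemLp ψ 2 (volume.restrict (Set.Ioo t₁ t₂)))
    (_ : ∃ z₀, IsSkeleton N F hμ t₁ t₂ z₀ ψ z),
    eLpNorm ψ 2 (volume.restrict (Set.Ioo t₁ t₂)) ^ 2

/-- `I^μ_{-∞}(z) = sup_{t < 0} I^μ_{t,0}(z)`. -/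
def actionInfty {D : SpectralBasis H} (N : DiagonalNoise D) (F : H → ℝ) {μ : ℝ} (hμ : 0 < μ)
    (z : ℝ → Phase D) : ℝ≥0∞ :=
  ⨆ (t : ℝ) (_ : t < 0), action N F hμ t 0 z

/-- The quasi-potential
`V^μ(x,y) = inf {I^μ_{0,T}(z) : z ∈ C([0,T];𝓗), z(0) = 0, z(T) = (x,y), T > 0}`. -/
def quasiPotential {D : SpectralBasis H} (N : DiagonalNoise D) (F : H → ℝ) {μ : ℝ} (hμ : 0 < μ)
    (x : H) (y : HMinusOne D) : ℝ≥0∞ :=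
  ⨅ (T : ℝ) (_ : 0 < T) (z : ℝ → Phase D) (_ : ContinuousOn z (Set.Icc 0 T)) (_ : z 0 = 0)
    (_ : z T = WithLp.toLp 2 (x, y)), action N F hμ 0 T z

end DampedWave

end

/-!
Both assertions rest on the exact controllability of the linear equation, in any positive time, with
a control bounded by the target.

**Controllability.** All operators are diagonal in the eigenbasis, and the multiplier
`(-2A)^{-1/2} Q` commutes with the group `S_μ`. Pulling it out of `Q_μ` leaves the input operator
`μ⁻¹ (0, (-2A)^{1/2} ·)`, and pulling it out of `C_μ^{1/2}` leaves an operator that is invertible up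
to the kernel of `Q`. It is therefore enough to steer `0` to an arbitrary state of `𝓗` with this
input operator (`exists_control_rootInput`). On a mode, take the free solution `w` with the
prescribed final state, multiply it by a smooth ramp `θ` from `0` to `1` with vanishing slope at both
ends, and read off the forcing `(θ'' + θ' / μ) w + 2 θ' w'`. No multiple of `-A w` appears in it, so
after division by the square root of the eigenvalue it is bounded in `L²` by the energy of the
target, uniformly over the modes.

**Quasi-potential.** A path from `0` on `[0, T]` can be translated to `[-T, 0]` and extended by `0`,
which solves the equation because `DF(0) = 0`, the point `0` being a minimum of `F`
(`exists_extension`). Conversely, if `|C_μ^{-1/2} z(t)|` is small, then `z(t)` is reached from `0`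
in unit time along a path of the linear equation; this path also solves the skeleton equation after
the drift `Q DF` along it is added to the control, and the Lipschitz bound keeps the cost of order
`|C_μ^{-1/2} z(t)|²` (`exists_path_action_le`). Gluing this path to `z` on `[t, 0]` and letting
`t → -∞` gives the other inequality. Since `S_μ` is a group, the mild equation can be written as an
integral identity that is additive in the time interval (`IsTransported`), so restriction, gluing and
translation of paths reduce to additivity of integrals.
-/

noncomputable section

namespace DampedWave

variable {H : Type*} [NormedAddCommGroup H] [InnerProductSpace ℝ H]

/-! ### The group law on a single mode and on the phase space -/

open scoped Matrix.Norms.Operator in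
theorem modeFlow_add (μ a s t : ℝ) : modeFlow μ a (s + t) = modeFlow μ a s * modeFlow μ a t := by
  rw [modeFlow, add_smul]
  exact Matrix.exp_add_of_commute _ _ (((Commute.refl _).smul_left s).smul_right t)

open scoped Matrix.Norms.Operator in
/-- The derivative of the matrix exponential with the generator on the right. -/
theorem hasDerivAt_modeFlow' (μ a t : ℝ) (i j : Fin 2) :
    HasDerivAt (fun s => modeFlow μ a s i j) ((modeFlow μ a t * modeMatrix μ a) i j) t := by
  have h := hasDerivAt_exp_smul_const (𝕂 := ℝ) (modeMatrix μ a) t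
  exact hasDerivAt_pi.1 (hasDerivAt_pi.1 h i) j

theorem continuous_modeFlow (μ a : ℝ) (i j : Fin 2) : Continuous fun t => modeFlow μ a t i j :=
  continuous_iff_continuousAt.2 fun t => (hasDerivAt_modeFlow μ a t i j).continuousAt

theorem Phase.ext_coeff (D : SpectralBasis H) {z w : Phase D}
    (h₁ : ∀ k, D.coeff z.fst k = D.coeff w.fst k) (h₂ : ∀ k, z.snd.coeff k = w.snd.coeff k) :
    z = w :=
  WithLp.ofLp_injective 2 (Prod.ext (D.ext_coeff h₁) (HMinusOne.ext_coeff h₂))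

theorem S_zero (D : SpectralBasis H) {μ : ℝ} (hμ : 0 < μ) (z : Phase D) : S D hμ 0 z = z := by
  refine Phase.ext_coeff D (fun k => ?_) fun k => ?_
  · simp [coeff_S_fst, modeFlow_zero]
  · simp [coeff_S_snd, modeFlow_zero]

theorem S_add (D : SpectralBasis H) {μ : ℝ} (hμ : 0 < μ) (s t : ℝ) (z : Phase D) :
    S D hμ (s + t) z = S D hμ s (S D hμ t z) := by
  refine Phase.ext_coeff D (fun k => ?_) fun k => ?_
  · simp only [coeff_S_fst, coeff_S_snd, modeFlow_add, Matrix.mul_apply, Fin.sum_univ_two]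
    ring
  · simp only [coeff_S_fst, coeff_S_snd, modeFlow_add, Matrix.mul_apply, Fin.sum_univ_two]
    ring

theorem S_neg_S (D : SpectralBasis H) {μ : ℝ} (hμ : 0 < μ) (t : ℝ) (z : Phase D) :
    S D hμ (-t) (S D hμ t z) = z := by
  rw [← S_add, neg_add_cancel, S_zero]

theorem S_S_neg (D : SpectralBasis H) {μ : ℝ} (hμ : 0 < μ) (t : ℝ) (z : Phase D) :
    S D hμ t (S D hμ (-t) z) = z := by
  rw [← S_add, add_neg_cancel, S_zero]

/-! ### Coefficients of phase vectors and scalar multipliers -/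

/-- The `k`-th Fourier coefficient of the first component, as a continuous functional. -/
def fstCoeff (D : SpectralBasis H) (k : ℕ) : Phase D →L[ℝ] ℝ :=
  (innerSL ℝ (D.e k)) ∘L WithLp.fstL 2 ℝ H (HMinusOne D)

/-- The `k`-th Fourier coefficient of the second component, as a continuous functional. -/
def sndCoeff (D : SpectralBasis H) (k : ℕ) : Phase D →L[ℝ] ℝ :=
  √(D.α k) • (lp.evalCLM ℝ (fun _ : ℕ => ℝ) 2 k ∘L
    (negIso D).toContinuousLinearEquiv.toContinuousLinearMap ∘L WithLp.sndL 2 ℝ H (HMinusOne D))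

theorem fstCoeff_apply (D : SpectralBasis H) (k : ℕ) (z : Phase D) :
    fstCoeff D k z = D.coeff z.fst k := rfl

theorem sndCoeff_apply (D : SpectralBasis H) (k : ℕ) (z : Phase D) :
    sndCoeff D k z = z.snd.coeff k := by
  have : √(D.α k) ≠ 0 := (Real.sqrt_pos.2 (D.α_pos k)).ne'
  exact mul_inv_cancel_left₀ this (z.snd.coeff k)

theorem Phase.ext_functional (D : SpectralBasis H) {z w : Phase D}
    (h₁ : ∀ k, fstCoeff D k z = fstCoeff D k w) (h₂ : ∀ k, sndCoeff D k z = sndCoeff D k w) :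
    z = w :=
  Phase.ext_coeff D h₁ fun k => by simpa only [sndCoeff_apply] using h₂ k

/-- The diagonal operator on `𝓗` that multiplies both `k`-th Fourier coefficients by `m k`. -/
def phaseMul (D : SpectralBasis H) (m : ℕ → ℝ) (hm : ∃ K, ∀ k, |m k| ≤ K) :
    Phase D →L[ℝ] Phase D :=
  blockOp D (mulHH D m hm) 0 0 (mulNN D m hm)

theorem coeff_phaseMul_fst (D : SpectralBasis H) (m : ℕ → ℝ) (hm) (z : Phase D) (k : ℕ) :
    D.coeff (phaseMul D m hm z).fst k = m k * D.coeff z.fst k := by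
  rw [← coeff_mulHH D m hm]
  simp [phaseMul, blockOp_apply]

theorem coeff_phaseMul_snd (D : SpectralBasis H) (m : ℕ → ℝ) (hm) (z : Phase D) (k : ℕ) :
    (phaseMul D m hm z).snd.coeff k = m k * z.snd.coeff k := by
  rw [← coeff_mulNN D m hm]
  simp [phaseMul, blockOp_apply]

theorem S_phaseMul (D : SpectralBasis H) {μ : ℝ} (hμ : 0 < μ) (m : ℕ → ℝ) (hm) (t : ℝ)
    (z : Phase D) : S D hμ t (phaseMul D m hm z) = phaseMul D m hm (S D hμ t z) := by
  refine Phase.ext_coeff D (fun k => ?_) fun k => ?_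
  · simp only [coeff_S_fst, coeff_phaseMul_fst, coeff_phaseMul_snd]
    ring
  · simp only [coeff_S_snd, coeff_phaseMul_fst, coeff_phaseMul_snd]
    ring

/-! ### Factorization of the noise operator and of the covariance -/

theorem noiseFactor_bound {D : SpectralBasis H} (N : DiagonalNoise D) :
    ∃ K, ∀ k, |√(1 / (2 * D.α k)) * N.lam k| ≤ K :=
  ⟨_, fun k => by simpa [abs_mul] using covSqrt_bound N two_pos k⟩

/-- The multiplier `lam k / √(2 α k)`, that is `(-2A)^{-1/2} Q` acting on both components. It
commutes with the semigroup, and both `Q_μ` and `C_μ^{1/2}` are this operator composed with an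
operator that does not involve the noise coefficients except through their sign. -/
def noiseFactor {D : SpectralBasis H} (N : DiagonalNoise D) : Phase D →L[ℝ] Phase D :=
  phaseMul D (fun k => √(1 / (2 * D.α k)) * N.lam k) (noiseFactor_bound N)

theorem S_noiseFactor {D : SpectralBasis H} (N : DiagonalNoise D) {μ : ℝ} (hμ : 0 < μ) (t : ℝ)
    (z : Phase D) : S D hμ t (noiseFactor N z) = noiseFactor N (S D hμ t z) :=
  S_phaseMul D hμ _ _ t z

/-- The operator `h ↦ μ⁻¹ (0, (-2A)^{1/2} h)` from `H` to `𝓗`. -/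
def rootInput (D : SpectralBasis H) (μ : ℝ) : H →L[ℝ] Phase D :=
  (WithLp.prodContinuousLinearEquiv 2 ℝ H (HMinusOne D)).symm.toContinuousLinearMap ∘L
    ContinuousLinearMap.inr ℝ H (HMinusOne D) ∘L
    mulHN D (fun k => √(2 * D.α k) / μ) ⟨√2 / |μ|, fun k => by
      have := (Real.sqrt_pos.2 (D.α_pos k)).ne'
      rw [Real.sqrt_mul (by norm_num), abs_mul, abs_div, abs_mul, abs_inv,
        abs_of_nonneg (Real.sqrt_nonneg (D.α k)), abs_of_nonneg (Real.sqrt_nonneg 2)]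
      apply le_of_eq
      field_simp⟩

theorem coeff_rootInput_fst (D : SpectralBasis H) (μ : ℝ) (h : H) (k : ℕ) :
    D.coeff (rootInput D μ h).fst k = 0 := by
  simp [rootInput, SpectralBasis.coeff]

theorem coeff_rootInput_snd (D : SpectralBasis H) (μ : ℝ) (h : H) (k : ℕ) :
    (rootInput D μ h).snd.coeff k = √(2 * D.α k) / μ * D.coeff h k :=
  coeff_mulHN D _ _ h k

theorem DiagonalNoise.coeff_Q {D : SpectralBasis H} (N : DiagonalNoise D) (h : H) (k : ℕ) :
    D.coeff (N.Q h) k = N.lam k * D.coeff h k := by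
  -- Both sides are continuous linear functionals of `h` that agree on the basis.
  have h1 : (innerSL ℝ (D.e k)) ∘L N.Q = N.lam k • innerSL ℝ (D.e k) := by
    refine ContinuousLinearMap.ext_on
      (Submodule.dense_iff_topologicalClosure_eq_top.2 D.e.dense_span) ?_
    rintro _ ⟨j, rfl⟩
    rcases eq_or_ne k j with rfl | hkj
    · simp [N.diagonal]
    · simp [N.diagonal, D.e.orthonormal.inner_eq_zero hkj]
  exact DFunLike.congr_fun h1 h

theorem Qmu_eq {D : SpectralBasis H} (N : DiagonalNoise D) (μ : ℝ) (h : H) :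
    Qmu N μ h = noiseFactor N (rootInput D μ h) := by
  refine Phase.ext_coeff D (fun k => ?_) fun k => ?_
  · rw [noiseFactor, coeff_phaseMul_fst, coeff_rootInput_fst, mul_zero]
    simp [Qmu, SpectralBasis.coeff]
  · rw [noiseFactor, coeff_phaseMul_snd, coeff_rootInput_snd]
    have h1 : (Qmu N μ h).snd.coeff k = μ⁻¹ * (embed D (N.Q h)).coeff k := rfl
    have h2 : √(1 / (2 * D.α k)) * √(2 * D.α k) = 1 := by
      have := D.α_pos k
      rw [← Real.sqrt_mul (by positivity), one_div, inv_mul_cancel₀ (by positivity), Real.sqrt_one]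
    rw [h1, embed, coeff_mulHN, N.coeff_Q]
    linear_combination (- N.lam k * D.coeff h k / μ) * h2

theorem covSqrt_coeff_fst {D : SpectralBasis H} (N : DiagonalNoise D) {μ : ℝ} (hμ : 0 < μ)
    (z : Phase D) (k : ℕ) :
    D.coeff (covSqrt N hμ z).fst k = √(1 / (2 * D.α k)) * |N.lam k| * D.coeff z.fst k := by
  rw [← coeff_mulHH D (fun k => √(1 / (2 * D.α k)) * |N.lam k|) ⟨_, covSqrt_bound N two_pos⟩]
  simp [covSqrt, blockOp_apply]

theorem covSqrt_coeff_snd {D : SpectralBasis H} (N : DiagonalNoise D) {μ : ℝ} (hμ : 0 < μ)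
    (z : Phase D) (k : ℕ) :
    (covSqrt N hμ z).snd.coeff k = √(1 / (2 * μ * D.α k)) * |N.lam k| * z.snd.coeff k := by
  rw [← coeff_mulNN D (fun k => √(1 / (2 * μ * D.α k)) * |N.lam k|)
    ⟨_, covSqrt_bound N (mul_pos two_pos hμ)⟩]
  simp [covSqrt, blockOp_apply]

theorem sign_bound {D : SpectralBasis H} (N : DiagonalNoise D) :
    ∃ K : ℝ, ∀ k, |((SignType.sign (N.lam k) : SignType) : ℝ)| ≤ K :=
  ⟨1, fun k => by rcases lt_trichotomy (N.lam k) 0 with h | h | h <;> simp [h]⟩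

/-- The operator `(u, v) ↦ (sgn(Q) u, c sgn(Q) v)` on `𝓗`. The sign turns `Q` into `|Q|`, and
`c = μ^{-1/2}` accounts for the different weights of the two blocks of `C_μ`. -/
def signScale {D : SpectralBasis H} (N : DiagonalNoise D) (c : ℝ) : Phase D →L[ℝ] Phase D :=
  blockOp D (mulHH D (fun k => SignType.sign (N.lam k)) (sign_bound N)) 0 0
    (c • mulNN D (fun k => SignType.sign (N.lam k)) (sign_bound N))

theorem coeff_signScale_fst {D : SpectralBasis H} (N : DiagonalNoise D) (c : ℝ) (z : Phase D)
    (k : ℕ) : D.coeff (signScale N c z).fst k = SignType.sign (N.lam k) * D.coeff z.fst k := by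
  rw [← coeff_mulHH D (fun k => SignType.sign (N.lam k)) (sign_bound N)]
  simp [signScale, blockOp_apply]

theorem coeff_signScale_snd {D : SpectralBasis H} (N : DiagonalNoise D) (c : ℝ) (z : Phase D)
    (k : ℕ) :
    (signScale N c z).snd.coeff k = c * (SignType.sign (N.lam k) * z.snd.coeff k) := by
  rw [← coeff_mulNN D (fun k => SignType.sign (N.lam k)) (sign_bound N)]
  simp only [signScale, blockOp_apply, WithLp.toLp_snd, _root_.zero_apply, zero_add]
  rfl

theorem sqrt_cov_weight {D : SpectralBasis H} {μ : ℝ} (hμ : 0 < μ) (k : ℕ) :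
    √(1 / (2 * μ * D.α k)) = √(1 / (2 * D.α k)) * (√μ)⁻¹ := by
  have := D.α_pos k
  rw [← Real.sqrt_inv, ← Real.sqrt_mul (by positivity)]
  congr 1
  field_simp

theorem covSqrt_eq {D : SpectralBasis H} (N : DiagonalNoise D) {μ : ℝ} (hμ : 0 < μ)
    (w : Phase D) : covSqrt N hμ w = noiseFactor N (signScale N (√μ)⁻¹ w) := by
  refine Phase.ext_coeff D (fun k => ?_) fun k => ?_
  · have h := self_mul_sign (N.lam k)
    rw [covSqrt_coeff_fst, noiseFactor, coeff_phaseMul_fst, coeff_signScale_fst, ← h]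
    ring
  · have h := self_mul_sign (N.lam k)
    rw [covSqrt_coeff_snd, noiseFactor, coeff_phaseMul_snd, coeff_signScale_snd, ← h,
      sqrt_cov_weight hμ]
    ring

theorem noiseFactor_eq {D : SpectralBasis H} (N : DiagonalNoise D) {μ : ℝ} (hμ : 0 < μ)
    (w : Phase D) : noiseFactor N w = covSqrt N hμ (signScale N √μ w) := by
  refine Phase.ext_coeff D (fun k => ?_) fun k => ?_
  · have h := abs_mul_sign (N.lam k)
    rw [covSqrt_coeff_fst, noiseFactor, coeff_phaseMul_fst, coeff_signScale_fst]
    nth_rw 1 [← h]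
    ring
  · have h := abs_mul_sign (N.lam k)
    have h' : (√μ)⁻¹ * √μ = 1 := inv_mul_cancel₀ (Real.sqrt_pos.2 hμ).ne'
    rw [covSqrt_coeff_snd, noiseFactor, coeff_phaseMul_snd, coeff_signScale_snd,
      sqrt_cov_weight hμ]
    nth_rw 1 [← h]
    linear_combination (-(√(1 / (2 * D.α k)) * |N.lam k| * SignType.sign (N.lam k) *
      w.snd.coeff k)) * h'

/-- The range of `C_μ^{1/2}` is the range of the noise multiplier. -/
theorem range_covSqrt {D : SpectralBasis H} (N : DiagonalNoise D) {μ : ℝ} (hμ : 0 < μ) :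
    Set.range (covSqrt N hμ) = Set.range (noiseFactor N) := by
  refine Set.Subset.antisymm ?_ ?_
  · rintro _ ⟨w, rfl⟩
    exact ⟨_, (covSqrt_eq N hμ w).symm⟩
  · rintro _ ⟨w, rfl⟩
    exact ⟨_, (noiseFactor_eq N hμ w).symm⟩

/-! ### Strong continuity of the group -/

/-- Dominated convergence in `ℓ²`: if the multipliers `m x` depend continuously on `x` coefficient
by coefficient and are locally uniformly bounded, then `x ↦ (m x k * f k)_k` is continuous. -/
theorem continuous_mulL2 {X : Type*} [TopologicalSpace X] {m : X → ℕ → ℝ}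
    (hm : ∀ x, ∃ K, ∀ k, |m x k| ≤ K) (hc : ∀ k, Continuous fun x => m x k)
    (hb : ∀ x₀, ∃ K, ∀ᶠ x in 𝓝 x₀, ∀ k, |m x k| ≤ K) (f : ℓ²(ℕ, ℝ)) :
    Continuous fun x => mulL2 (m x) (hm x) f := by
  refine continuous_iff_continuousAt.2 fun x₀ => ?_
  have hf : Summable fun k => f k ^ 2 := by
    simpa [sq_abs] using (memℓp_gen_iff (p := 2) (by simp)).1 (lp.memℓp f)
  have hn : ∀ x, ‖mulL2 (m x) (hm x) f - mulL2 (m x₀) (hm x₀) f‖ ^ 2 =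
      ∑' k, (m x k - m x₀ k) ^ 2 * f k ^ 2 := fun x => by
    have h := lp.norm_rpow_eq_tsum (p := 2) (by simp)
      (mulL2 (m x) (hm x) f - mulL2 (m x₀) (hm x₀) f)
    simp only [ENNReal.toReal_ofNat, Real.rpow_ofNat, lp.coeFn_sub, Pi.sub_apply, mulL2_apply,
      Real.norm_eq_abs, sq_abs] at h
    rw [h]
    exact tsum_congr fun k => by ring
  obtain ⟨K, hK⟩ := hb x₀
  have hT : Tendsto (fun x => ∑' k, (m x k - m x₀ k) ^ 2 * f k ^ 2) (𝓝 x₀)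
      (𝓝 (∑' _ : ℕ, (0 : ℝ))) := by
    refine tendsto_tsum_of_dominated_convergence (hf.mul_left ((2 * K) ^ 2)) (fun k => ?_) ?_
    · have : Continuous fun x => (m x k - m x₀ k) ^ 2 * f k ^ 2 := by
        have := hc k
        fun_prop
      simpa using this.tendsto x₀
    · filter_upwards [hK] with x hx k
      rw [Real.norm_of_nonneg (by positivity)]
      refine mul_le_mul_of_nonneg_right (sq_le_sq' ?_ ?_) (sq_nonneg _)
      · linarith [neg_abs_le (m x k), le_abs_self (m x₀ k), hx k, hK.self_of_nhds k]
      · linarith [neg_abs_le (m x₀ k), le_abs_self (m x k), hx k, hK.self_of_nhds k]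
  rw [ContinuousAt, tendsto_iff_norm_sub_tendsto_zero]
  have h2 := hT.sqrt
  simpa [← hn, Real.sqrt_sq (norm_nonneg _)] using h2

/-- A bound by a continuous function gives a locally uniform bound. -/
theorem eventually_abs_le_of_continuous {ι : Type*} {m : ℝ → ι → ℝ} {B : ℝ → ℝ}
    (hB : Continuous B) (h : ∀ t k, |m t k| ≤ B t) (t₀ : ℝ) :
    ∃ K, ∀ᶠ t in 𝓝 t₀, ∀ k, |m t k| ≤ K :=
  ⟨B t₀ + 1, ((hB.tendsto t₀).eventually (gt_mem_nhds (lt_add_one (B t₀)))).mono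
    fun t ht k => (h t k).trans (le_of_lt ht)⟩

theorem continuous_S (D : SpectralBasis H) {μ : ℝ} (hμ : 0 < μ) (z : Phase D) :
    Continuous fun t => S D hμ t z := by
  have hb := fun t k => modeFlow_bounds hμ (D.α_pos k) t
  have c00 : Continuous fun t => mulHH D (fun k => modeFlow μ (D.α k) t 0 0)
      ⟨_, fun k => (hb t k).1⟩ z.fst :=
    D.e.repr.symm.continuous.comp (continuous_mulL2
      (fun t => ⟨_, fun k => (hb t k).1⟩)
      (fun k => continuous_modeFlow μ _ 0 0)
      (eventually_abs_le_of_continuous (by fun_prop) fun t k => (hb t k).1) _)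
  have c01 : Continuous fun t => mulNH D (fun k => modeFlow μ (D.α k) t 0 1)
      ⟨_, fun k => (hb t k).2.1⟩ z.snd :=
    D.e.repr.symm.continuous.comp (continuous_mulL2
      (fun t => ⟨_, fun k => (hb t k).2.1⟩)
      (fun k => (continuous_modeFlow μ _ 0 1).mul continuous_const)
      (eventually_abs_le_of_continuous (by fun_prop) fun t k => (hb t k).2.1) _)
  have c10 : Continuous fun t => mulHN D (fun k => modeFlow μ (D.α k) t 1 0)
      ⟨_, fun k => (hb t k).2.2.1⟩ z.fst :=
    (negIso D).symm.continuous.comp (continuous_mulL2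
      (fun t => ⟨_, fun k => (hb t k).2.2.1⟩)
      (fun k => continuous_const.mul (continuous_modeFlow μ _ 1 0))
      (eventually_abs_le_of_continuous (by fun_prop) fun t k => (hb t k).2.2.1) _)
  have c11 : Continuous fun t => mulNN D (fun k => modeFlow μ (D.α k) t 1 1)
      ⟨_, fun k => (hb t k).2.2.2⟩ z.snd :=
    (negIso D).symm.continuous.comp (continuous_mulL2
      (fun t => ⟨_, fun k => (hb t k).2.2.2⟩)
      (fun k => continuous_modeFlow μ _ 1 1)
      (eventually_abs_le_of_continuous (by fun_prop) fun t k => (hb t k).2.2.2) _)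
  exact (WithLp.prodContinuousLinearEquiv 2 ℝ H (HMinusOne D)).symm.continuous.comp
    ((c00.add c01).prodMk (c10.add c11))

section StronglyContinuous

variable {E G : Type*} [NormedAddCommGroup E] [NormedSpace ℝ E] [CompleteSpace E]
  [NormedAddCommGroup G] [NormedSpace ℝ G]

/-- A strongly continuous family of bounded operators is bounded on compact intervals, by the
uniform boundedness principle. -/
theorem exists_bound_of_strongly_continuous {Φ : ℝ → E →L[ℝ] G}
    (h : ∀ z, Continuous fun s => Φ s z) (a b : ℝ) :
    ∃ C : ℝ≥0, ∀ s ∈ Set.Icc a b, ∀ z, ‖Φ s z‖ ≤ C * ‖z‖ := by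
  obtain ⟨C, hC⟩ := banach_steinhaus (g := fun s : Set.Icc a b => Φ s) fun z => by
    obtain ⟨C, hC⟩ := isCompact_Icc.exists_bound_of_continuousOn (h z).continuousOn
    exact ⟨C, fun s => hC s s.2⟩
  exact ⟨C.toNNReal, fun s hs z => ((Φ s).le_opNorm z).trans
    (mul_le_mul_of_nonneg_right ((hC ⟨s, hs⟩).trans (Real.le_coe_toNNReal C)) (norm_nonneg z))⟩

theorem continuous_uncurry_of_strongly_continuous {Φ : ℝ → E →L[ℝ] G}
    (h : ∀ z, Continuous fun s => Φ s z) : Continuous fun p : ℝ × E => Φ p.1 p.2 := by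
  refine continuous_iff_continuousAt.2 fun ⟨s₀, z₀⟩ => ?_
  obtain ⟨C, hC⟩ := exists_bound_of_strongly_continuous h (s₀ - 1) (s₀ + 1)
  have h1 : Tendsto (fun p : ℝ × E => Φ p.1 (p.2 - z₀)) (𝓝 (s₀, z₀)) (𝓝 0) := by
    have hz : Tendsto (fun p : ℝ × E => (C : ℝ) * ‖p.2 - z₀‖) (𝓝 (s₀, z₀)) (𝓝 0) := by
      have : Continuous fun p : ℝ × E => (C : ℝ) * ‖p.2 - z₀‖ := by fun_prop
      simpa using this.tendsto (s₀, z₀)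
    refine squeeze_zero_norm' ?_ hz
    have hs : ∀ᶠ p : ℝ × E in 𝓝 (s₀, z₀), p.1 ∈ Set.Icc (s₀ - 1) (s₀ + 1) :=
      continuous_fst.continuousAt (Icc_mem_nhds (by simp) (by simp))
    filter_upwards [hs] with p hp using hC _ hp _
  have h2 : Tendsto (fun p : ℝ × E => Φ p.1 z₀) (𝓝 (s₀, z₀)) (𝓝 (Φ s₀ z₀)) :=
    ((h z₀).comp continuous_fst).tendsto (s₀, z₀)
  simpa [ContinuousAt] using h1.add h2

theorem continuous_apply_of_strongly_continuous {Φ : ℝ → E →L[ℝ] G}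
    (h : ∀ z, Continuous fun s => Φ s z) {f : ℝ → ℝ} {g : ℝ → E} (hf : Continuous f)
    (hg : Continuous g) : Continuous fun s => Φ (f s) (g s) :=
  (continuous_uncurry_of_strongly_continuous h).comp (hf.prodMk hg)

/-- A strongly continuous family of operators maps locally integrable functions to locally
integrable functions. -/
theorem intervalIntegrable_of_strongly_continuous {Φ : ℝ → E →L[ℝ] G}
    (h : ∀ z, Continuous fun s => Φ s z) {g : ℝ → E} {a b : ℝ}
    (hg : IntervalIntegrable g volume a b) :
    IntervalIntegrable (fun s => Φ s (g s)) volume a b := by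
  obtain ⟨C, hC⟩ := exists_bound_of_strongly_continuous h (min a b) (max a b)
  rw [intervalIntegrable_iff] at hg ⊢
  refine (hg.norm.const_mul (C : ℝ)).mono ?_ ?_
  · exact (continuous_uncurry_of_strongly_continuous h).comp_aestronglyMeasurable
      (aestronglyMeasurable_id.prodMk hg.aestronglyMeasurable)
  · refine ae_restrict_of_forall_mem measurableSet_uIoc fun s hs => ?_
    have := hC s (Set.uIoc_subset_uIcc hs) (g s)
    rwa [Real.norm_of_nonneg (by positivity)]

end StronglyContinuous

theorem continuous_S_sub (D : SpectralBasis H) {μ : ℝ} (hμ : 0 < μ) (t : ℝ) (z : Phase D) :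
    Continuous fun s => S D hμ (t - s) z :=
  (continuous_S D hμ z).comp (continuous_const.sub continuous_id)

theorem continuous_S_neg (D : SpectralBasis H) {μ : ℝ} (hμ : 0 < μ) (z : Phase D) :
    Continuous fun s => S D hμ (-s) z :=
  (continuous_S D hμ z).comp continuous_neg

theorem intervalIntegrable_of_memLp {E : Type*} [NormedAddCommGroup E] {ψ : ℝ → E} {a b : ℝ}
    (hab : a ≤ b) (hψ : MemLp ψ 2 (volume.restrict (Set.Ioo a b))) :
    IntervalIntegrable ψ volume a b := by
  rw [intervalIntegrable_iff_integrableOn_Ioo_of_le hab]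
  exact hψ.integrable one_le_two

/-! ### Moving the end time out of the convolution -/

section Convolution

variable [CompleteSpace H]

theorem continuous_S_apply (D : SpectralBasis H) {μ : ℝ} (hμ : 0 < μ) {f : ℝ → ℝ}
    {g : ℝ → Phase D} (hf : Continuous f) (hg : Continuous g) :
    Continuous fun s => S D hμ (f s) (g s) :=
  continuous_apply_of_strongly_continuous (Φ := fun s => S D hμ s) (continuous_S D hμ) hf hg

/-- By the group law, the convolution with `S_μ` is `S_μ(t)` applied to a primitive. -/
theorem integral_S_sub (D : SpectralBasis H) {μ : ℝ} (hμ : 0 < μ) {g : ℝ → Phase D} {a b : ℝ}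
    (hg : IntervalIntegrable g volume a b) (t : ℝ) :
    ∫ s in a..b, S D hμ (t - s) (g s) = S D hμ t (∫ s in a..b, S D hμ (-s) (g s)) := by
  rw [← ContinuousLinearMap.intervalIntegral_comp_comm _
    (intervalIntegrable_of_strongly_continuous (continuous_S_neg D hμ) hg)]
  simp only [← S_add, sub_eq_add_neg]

end Convolution

/-! ### Exact controllability of the linear equation -/

/-- There is a `C²` ramp from `0` to `1` on `[0, τ]` with vanishing slope at both ends. -/
theorem exists_ramp {τ : ℝ} (hτ : 0 < τ) :
    ∃ θ θ₁ θ₂ : ℝ → ℝ, (∀ s, HasDerivAt θ (θ₁ s) s) ∧ (∀ s, HasDerivAt θ₁ (θ₂ s) s) ∧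
      Continuous θ₂ ∧ θ 0 = 0 ∧ θ₁ 0 = 0 ∧ θ τ = 1 ∧ θ₁ τ = 0 := by
  refine ⟨fun s => 3 * (s / τ) ^ 2 - 2 * (s / τ) ^ 3, fun s => 6 / τ * (s / τ - (s / τ) ^ 2),
    fun s => 6 / τ * (1 / τ - 2 * (s / τ) * (1 / τ)), fun s => ?_, fun s => ?_, by fun_prop,
    by simp, by simp, ?_, ?_⟩
  · have h := (hasDerivAt_id s).div_const τ
    refine (((h.pow 2).const_mul 3).sub ((h.pow 3).const_mul 2)).congr_deriv ?_
    push_cast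
    simp only [id]
    ring
  · have h := (hasDerivAt_id s).div_const τ
    refine ((h.sub (h.pow 2)).const_mul (6 / τ)).congr_deriv ?_
    push_cast
    simp only [id]
    ring
  · norm_num [div_self hτ.ne']
  · simp [div_self hτ.ne']

/-- If `w` solves the free equation on a mode, then `θ w` solves it with the forcing
`(θ'' + θ' / μ) w + 2 θ' w'`; here this is written after transport to the time `τ`. -/
theorem hasDerivAt_ramped_mode {μ : ℝ} (hμ : 0 < μ) (a τ p q : ℝ) {θ θ₁ θ₂ : ℝ → ℝ}
    (h₁ : ∀ s, HasDerivAt θ (θ₁ s) s) (h₂ : ∀ s, HasDerivAt θ₁ (θ₂ s) s) {w : Fin 2 → ℝ → ℝ}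
    (hw : ∀ i s, w i s = modeFlow μ a (s - τ) i 0 * p + modeFlow μ a (s - τ) i 1 * q)
    (i : Fin 2) (s : ℝ) :
    HasDerivAt (fun s => modeFlow μ a (τ - s) i 0 * (θ s * w 0 s) +
        modeFlow μ a (τ - s) i 1 * (θ₁ s * w 0 s + θ s * w 1 s))
      (modeFlow μ a (τ - s) i 1 * ((θ₂ s + θ₁ s / μ) * w 0 s + 2 * θ₁ s * w 1 s)) s := by
  have dP : ∀ j, HasDerivAt (fun s => modeFlow μ a (τ - s) i j)
      (-(modeFlow μ a (τ - s) * modeMatrix μ a) i j) s := fun j => by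
    simpa using (hasDerivAt_modeFlow' μ a (τ - s) i j).comp_const_sub τ s
  have dM : ∀ l j, HasDerivAt (fun s => modeFlow μ a (s - τ) l j)
      ((modeMatrix μ a * modeFlow μ a (s - τ)) l j) s := fun l j =>
    (hasDerivAt_modeFlow μ a (s - τ) l j).comp_sub_const s τ
  have dw : ∀ l, HasDerivAt (w l) ((modeMatrix μ a * modeFlow μ a (s - τ)) l 0 * p +
      (modeMatrix μ a * modeFlow μ a (s - τ)) l 1 * q) s := fun l => by
    rw [funext (hw l)]
    exact ((dM l 0).mul_const p).add ((dM l 1).mul_const q)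
  refine (((dP 0).mul ((h₁ s).mul (dw 0))).add
    ((dP 1).mul (((h₂ s).mul (dw 0)).add ((h₁ s).mul (dw 1))))).congr_deriv ?_
  simp only [Matrix.mul_apply, Fin.sum_univ_two, modeMatrix, hw, Matrix.of_apply,
    Pi.add_apply, Pi.mul_apply,
    Matrix.cons_val', Matrix.cons_val_zero, Matrix.cons_val_one, Matrix.cons_val_fin_one]
  field_simp
  ring

/-- The forcing of the ramped free solution steers the mode from `0` to the final value `(p, q)` of
the free solution. -/
theorem integral_ramped_mode {μ : ℝ} (hμ : 0 < μ) (a : ℝ) {τ : ℝ} (p q : ℝ) {θ θ₁ θ₂ : ℝ → ℝ}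
    (h₁ : ∀ s, HasDerivAt θ (θ₁ s) s) (h₂ : ∀ s, HasDerivAt θ₁ (θ₂ s) s) (hc₂ : Continuous θ₂)
    (θ0 : θ 0 = 0) (θ₁0 : θ₁ 0 = 0) (θτ : θ τ = 1) (θ₁τ : θ₁ τ = 0) {w : Fin 2 → ℝ → ℝ}
    (hw : ∀ i s, w i s = modeFlow μ a (s - τ) i 0 * p + modeFlow μ a (s - τ) i 1 * q)
    (i : Fin 2) :
    ∫ s in 0..τ, modeFlow μ a (τ - s) i 1 * ((θ₂ s + θ₁ s / μ) * w 0 s + 2 * θ₁ s * w 1 s) =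
      (1 : Matrix (Fin 2) (Fin 2) ℝ) i 0 * p + (1 : Matrix (Fin 2) (Fin 2) ℝ) i 1 * q := by
  have hc₁ : Continuous θ₁ := continuous_iff_continuousAt.2 fun s => (h₂ s).continuousAt
  have hcw : ∀ j, Continuous (w j) := fun j => by
    rw [funext (hw j)]
    exact (((continuous_modeFlow μ a j 0).comp (continuous_sub_right τ)).mul
      continuous_const).add
      (((continuous_modeFlow μ a j 1).comp (continuous_sub_right τ)).mul continuous_const)
  have hcm : Continuous fun s => modeFlow μ a (τ - s) i 1 :=
    (continuous_modeFlow μ a i 1).comp (continuous_sub_left τ)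
  have h0 := hcw 0
  have h1 := hcw 1
  rw [intervalIntegral.integral_eq_sub_of_hasDerivAt
    (fun s _ => hasDerivAt_ramped_mode hμ a τ p q h₁ h₂ hw i s)
    (Continuous.intervalIntegrable (by fun_prop) _ _)]
  simp [θ0, θ₁0, θτ, θ₁τ, hw, modeFlow_zero]

theorem rootInv_bound (D : SpectralBasis H) (μ : ℝ) : ∃ K, ∀ k, |μ / √(2 * D.α k)| ≤ K :=
  ⟨|μ| / √(2 * D.α 0), fun k => by
    have h0 := D.α_zero_pos
    have := D.α_mono (Nat.zero_le k)
    rw [abs_div, abs_of_nonneg (Real.sqrt_nonneg (2 * D.α k))]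
    gcongr⟩

theorem rootInv_bound' (D : SpectralBasis H) (μ : ℝ) :
    ∃ K, ∀ k, |μ / √(2 * D.α k) * √(D.α k)| ≤ K :=
  ⟨|μ| / √2, fun k => by
    have := (Real.sqrt_pos.2 (D.α_pos k)).ne'
    rw [Real.sqrt_mul (by norm_num), abs_mul, abs_div, abs_mul,
      abs_of_nonneg (Real.sqrt_nonneg (D.α k)), abs_of_nonneg (Real.sqrt_nonneg 2)]
    apply le_of_eq
    field_simp⟩

/-- The control `μ (-2A)^{-1/2} (b w + c w')`, where `(w, w')` is the free solution with value `z`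
at time `τ`. -/
def steeringControl (D : SpectralBasis H) {μ : ℝ} (hμ : 0 < μ) (τ : ℝ) (b c : ℝ → ℝ) (s : ℝ) :
    Phase D →L[ℝ] H :=
  (b s • (mulHH D (fun k => μ / √(2 * D.α k)) (rootInv_bound D μ) ∘L
      WithLp.fstL 2 ℝ H (HMinusOne D)) +
    c s • (mulNH D (fun k => μ / √(2 * D.α k)) (rootInv_bound' D μ) ∘L
      WithLp.sndL 2 ℝ H (HMinusOne D))) ∘L S D hμ (s - τ)

theorem coeff_steeringControl (D : SpectralBasis H) {μ : ℝ} (hμ : 0 < μ) (τ : ℝ) (b c : ℝ → ℝ)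
    (s : ℝ) (z : Phase D) (k : ℕ) :
    D.coeff (steeringControl D hμ τ b c s z) k = μ / √(2 * D.α k) *
      (b s * D.coeff (S D hμ (s - τ) z).fst k + c s * (S D hμ (s - τ) z).snd.coeff k) := by
  rw [mul_add, mul_left_comm, mul_left_comm _ (c s), ← coeff_mulHH D _ (rootInv_bound D μ),
    ← coeff_mulNH D _ (rootInv_bound' D μ)]
  simp only [SpectralBasis.coeff, ← real_inner_smul_right, ← inner_add_right]
  rfl

theorem coeff_rootInput_steeringControl (D : SpectralBasis H) {μ : ℝ} (hμ : 0 < μ) (τ : ℝ)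
    (b c : ℝ → ℝ) (s : ℝ) (z : Phase D) (k : ℕ) :
    (rootInput D μ (steeringControl D hμ τ b c s z)).snd.coeff k =
      b s * D.coeff (S D hμ (s - τ) z).fst k + c s * (S D hμ (s - τ) z).snd.coeff k := by
  have h : √(2 * D.α k) ≠ 0 := (Real.sqrt_pos.2 (mul_pos two_pos (D.α_pos k))).ne'
  rw [coeff_rootInput_snd, coeff_steeringControl]
  field_simp

theorem continuous_steeringControl (D : SpectralBasis H) {μ : ℝ} (hμ : 0 < μ) (τ : ℝ)
    {b c : ℝ → ℝ} (hb : Continuous b) (hc : Continuous c) (z : Phase D) :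
    Continuous fun s => steeringControl D hμ τ b c s z := by
  have hS : Continuous fun s => S D hμ (s - τ) z :=
    (continuous_S D hμ z).comp (continuous_id.sub continuous_const)
  exact (hb.smul (ContinuousLinearMap.continuous _ |>.comp hS)).add
    (hc.smul (ContinuousLinearMap.continuous _ |>.comp hS))

/-- `Q_μ` as a bounded operator. -/
def noiseInput {D : SpectralBasis H} (N : DiagonalNoise D) (μ : ℝ) : H →L[ℝ] Phase D :=
  noiseFactor N ∘L rootInput D μ

theorem noiseInput_apply {D : SpectralBasis H} (N : DiagonalNoise D) (μ : ℝ) (h : H) :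
    noiseInput N μ h = Qmu N μ h := (Qmu_eq N μ h).symm

theorem controlMap_comp_sub {D : SpectralBasis H} (N : DiagonalNoise D) {μ : ℝ} (hμ : 0 < μ)
    (a b : ℝ) (ψ : ℝ → H) :
    controlMap N hμ a b (fun s => ψ (s - a)) = controlMap N hμ 0 (b - a) ψ := by
  have h := intervalIntegral.integral_comp_sub_right (a := a) (b := b)
    (fun s => S D hμ (b - a - s) (Qmu N μ (ψ s))) a
  rw [sub_self] at h
  rw [controlMap, controlMap, ← h]
  simp only [sub_sub_sub_cancel_right]

section Controllability

variable [CompleteSpace H]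

/-- The equation with input operator `rootInput` can be steered from `0` to any state of `𝓗` in any
time `τ > 0`, with a control bounded linearly by the target. The controlled path is the free
solution ending at the target, multiplied by a ramp. -/
theorem exists_control_rootInput (D : SpectralBasis H) {μ : ℝ} (hμ : 0 < μ) {τ : ℝ}
    (hτ : 0 < τ) :
    ∃ C : ℝ≥0, ∀ z : Phase D, ∃ ψ : ℝ → H, Continuous ψ ∧
      (∀ s ∈ Set.Icc 0 τ, ‖ψ s‖ ≤ C * ‖z‖) ∧
      ∫ s in 0..τ, S D hμ (τ - s) (rootInput D μ (ψ s)) = z := by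
  obtain ⟨θ, θ₁, θ₂, h₁, h₂, hc₂, θ0, θ₁0, θτ, θ₁τ⟩ := exists_ramp hτ
  have hc₁ : Continuous θ₁ := continuous_iff_continuousAt.2 fun s => (h₂ s).continuousAt
  have hcont := continuous_steeringControl D hμ τ (b := fun s => θ₂ s + θ₁ s / μ)
    (c := fun s => 2 * θ₁ s) (by fun_prop) (by fun_prop)
  obtain ⟨C, hC⟩ := exists_bound_of_strongly_continuous hcont 0 τ
  refine ⟨C, fun z => ?_⟩
  obtain ⟨ψ, hψ⟩ : ∃ ψ : ℝ → H, ∀ s, ψ s =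
      steeringControl D hμ τ (fun s => θ₂ s + θ₁ s / μ) (fun s => 2 * θ₁ s) s z := ⟨_, fun _ => rfl⟩
  have hψc : Continuous ψ := by
    rw [funext hψ]
    exact hcont z
  refine ⟨ψ, hψc, fun s hs => ?_, ?_⟩
  · rw [hψ]
    exact hC s hs z
  have hint : Continuous fun s => S D hμ (τ - s) (rootInput D μ (ψ s)) :=
    continuous_S_apply D hμ (continuous_sub_left τ) ((rootInput D μ).continuous.comp hψc)
  have key : ∀ (i : Fin 2) (k : ℕ),
      ∫ s in 0..τ, modeFlow μ (D.α k) (τ - s) i 1 * (rootInput D μ (ψ s)).snd.coeff k =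
        (1 : Matrix (Fin 2) (Fin 2) ℝ) i 0 * D.coeff z.fst k +
          (1 : Matrix (Fin 2) (Fin 2) ℝ) i 1 * z.snd.coeff k := fun i k => by
    rw [← integral_ramped_mode hμ (D.α k) (D.coeff z.fst k) (z.snd.coeff k) h₁ h₂ hc₂ θ0 θ₁0 θτ
      θ₁τ (fun _ _ => rfl) i]
    refine intervalIntegral.integral_congr fun s _ => ?_
    simp only [hψ, coeff_rootInput_steeringControl, coeff_S_fst, coeff_S_snd]
  refine Phase.ext_functional D (fun k => ?_) fun k => ?_
  · rw [← ContinuousLinearMap.intervalIntegral_comp_comm _ (hint.intervalIntegrable _ _)]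
    simpa [fstCoeff_apply, coeff_S_fst, coeff_rootInput_fst] using key 0 k
  · rw [← ContinuousLinearMap.intervalIntegral_comp_comm _ (hint.intervalIntegrable _ _)]
    simpa [sndCoeff_apply, coeff_S_snd, coeff_rootInput_fst] using key 1 k

theorem intervalIntegrable_Qmu {D : SpectralBasis H} (N : DiagonalNoise D) (μ : ℝ) {ψ : ℝ → H}
    {a b : ℝ} (hψ : IntervalIntegrable ψ volume a b) :
    IntervalIntegrable (fun s => Qmu N μ (ψ s)) volume a b := by
  have h := intervalIntegrable_of_strongly_continuous (Φ := fun _ => noiseInput N μ)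
    (fun _ => continuous_const) hψ
  simpa only [noiseInput_apply] using h

theorem controlMap_eq_noiseFactor {D : SpectralBasis H} (N : DiagonalNoise D) {μ : ℝ}
    (hμ : 0 < μ) {a b : ℝ} {ψ : ℝ → H} (hψ : IntervalIntegrable ψ volume a b) :
    controlMap N hμ a b ψ = noiseFactor N (∫ s in a..b, S D hμ (b - s) (rootInput D μ (ψ s))) := by
  rw [← ContinuousLinearMap.intervalIntegral_comp_comm]
  · simp only [controlMap, Qmu_eq, S_noiseFactor]
  · exact intervalIntegrable_of_strongly_continuous (continuous_S_sub D hμ b)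
      (intervalIntegrable_of_strongly_continuous (Φ := fun _ => rootInput D μ)
        (fun _ => continuous_const) hψ)

theorem exists_control_covSqrt {D : SpectralBasis H} (N : DiagonalNoise D) {μ : ℝ} (hμ : 0 < μ)
    {τ : ℝ} (hτ : 0 < τ) :
    ∃ C : ℝ≥0, ∀ w : Phase D, ∃ ψ : ℝ → H, Continuous ψ ∧
      (∀ s ∈ Set.Icc 0 τ, ‖ψ s‖ ≤ C * ‖w‖) ∧ controlMap N hμ 0 τ ψ = covSqrt N hμ w := by
  obtain ⟨C, hC⟩ := exists_control_rootInput D hμ hτ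
  refine ⟨C * ‖signScale N (√μ)⁻¹‖₊, fun w => ?_⟩
  obtain ⟨ψ, h1, h2, h3⟩ := hC (signScale N (√μ)⁻¹ w)
  refine ⟨ψ, h1, fun s hs => (h2 s hs).trans ?_, ?_⟩
  · rw [NNReal.coe_mul, mul_assoc]
    exact mul_le_mul_of_nonneg_left (ContinuousLinearMap.le_opNorm _ _) C.2
  · rw [controlMap_eq_noiseFactor N hμ (h1.intervalIntegrable _ _), h3, covSqrt_eq]

/-- A function bounded by `K` on `(a, b)` has `L²` norm at most `(b - a)^{1/2} K` there. -/
theorem eLpNorm_le_of_bound {E : Type*} [NormedAddCommGroup E] {ψ : ℝ → E} {a b K : ℝ}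
    (h : ∀ s ∈ Set.Icc a b, ‖ψ s‖ ≤ K) :
    eLpNorm ψ 2 (volume.restrict (Set.Ioo a b)) ≤
      ENNReal.ofReal (b - a) ^ (2⁻¹ : ℝ) * ENNReal.ofReal K := by
  have := eLpNorm_le_of_ae_bound (p := 2) (μ := volume.restrict (Set.Ioo a b)) (f := ψ) (C := K)
    (ae_restrict_of_forall_mem measurableSet_Ioo fun s hs => h s (Set.Ioo_subset_Icc_self hs))
  simpa using this

theorem memLp_of_continuousOn {E : Type*} [NormedAddCommGroup E] {ψ : ℝ → E} {a b : ℝ}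
    (h : ContinuousOn ψ (Set.Icc a b)) : MemLp ψ 2 (volume.restrict (Set.Ioo a b)) := by
  obtain ⟨K, hK⟩ := isCompact_Icc.exists_bound_of_continuousOn h
  exact MemLp.of_bound ((h.mono Set.Ioo_subset_Icc_self).aestronglyMeasurable measurableSet_Ioo) K
    (ae_restrict_of_forall_mem measurableSet_Ioo fun s hs => hK s (Set.Ioo_subset_Icc_self hs))

/-- Every state `C_μ^{1/2} w` is reached from `0` on `[a, b]` at a cost bounded by `|w|`. -/
theorem exists_control_Ioo {D : SpectralBasis H} (N : DiagonalNoise D) {μ : ℝ} (hμ : 0 < μ)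
    {τ : ℝ} (hτ : 0 < τ) :
    ∃ C : ℝ≥0, ∀ a b : ℝ, b - a = τ → ∀ w : Phase D, ∃ ψ : ℝ → H,
      MemLp ψ 2 (volume.restrict (Set.Ioo a b)) ∧ controlMap N hμ a b ψ = covSqrt N hμ w ∧
      eLpNorm ψ 2 (volume.restrict (Set.Ioo a b)) ≤ C * ‖w‖ₑ := by
  obtain ⟨C, hC⟩ := exists_control_covSqrt N hμ hτ
  refine ⟨(τ ^ (2⁻¹ : ℝ)).toNNReal * C, fun a b hab w => ?_⟩
  obtain ⟨ψ, h1, h2, h3⟩ := hC w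
  refine ⟨fun s => ψ (s - a),
    memLp_of_continuousOn (h1.comp (continuous_sub_right a)).continuousOn, ?_, ?_⟩
  · rw [controlMap_comp_sub, hab, h3]
  · refine (eLpNorm_le_of_bound (K := C * ‖w‖) fun s hs => h2 _ ?_).trans (le_of_eq ?_)
    · exact ⟨by linarith [hs.1], by linarith [hs.2]⟩
    · rw [hab, ENNReal.ofReal_rpow_of_pos hτ, ENNReal.ofReal_mul NNReal.zero_le_coe,
        ENNReal.ofReal_coe_nnreal, ofReal_norm, ENNReal.coe_mul, mul_assoc]
      rfl

theorem image_controlMap {D : SpectralBasis H} (N : DiagonalNoise D) {μ : ℝ} (hμ : 0 < μ)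
    {a b : ℝ} (hab : a < b) :
    controlMap N hμ a b '' {ψ | MemLp ψ 2 (volume.restrict (Set.Ioo a b))} =
      Set.range (covSqrt N hμ) := by
  refine Set.Subset.antisymm ?_ ?_
  · rintro _ ⟨ψ, hψ, rfl⟩
    rw [range_covSqrt, controlMap_eq_noiseFactor N hμ (intervalIntegrable_of_memLp hab.le hψ)]
    exact ⟨_, rfl⟩
  · rintro _ ⟨w, rfl⟩
    obtain ⟨C, hC⟩ := exists_control_Ioo N hμ (sub_pos.2 hab)
    obtain ⟨ψ, h1, h2, -⟩ := hC a b rfl w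
    exact ⟨ψ, h1, h2⟩

theorem exists_controlCost_le {D : SpectralBasis H} (N : DiagonalNoise D) {μ : ℝ} (hμ : 0 < μ)
    {τ : ℝ} (hτ : 0 < τ) :
    ∃ C : ℝ≥0, ∀ a b : ℝ, b - a = τ → ∀ z : Phase D,
      controlCost N hμ a b z ≤ C * covInvSqrtNorm N hμ z := by
  obtain ⟨C, hC⟩ := exists_control_Ioo N hμ hτ
  -- The constant is made positive so that multiplication by it commutes with the infimum.
  refine ⟨C + 1, fun a b hab z => ?_⟩
  have h0 : ((C + 1 : ℝ≥0) : ℝ≥0∞) ≠ 0 := by simp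
  simp only [covInvSqrtNorm, ENNReal.mul_iInf_of_ne h0 ENNReal.coe_ne_top]
  refine le_iInf₂ fun w hw => ?_
  obtain ⟨ψ, h1, h2, h3⟩ := hC a b hab w
  refine (iInf_le_of_le ψ (iInf₂_le_of_le h1 (h2.trans hw) h3)).trans ?_
  gcongr
  exact le_self_add

end Controllability

/-! ### The skeleton equation as an integral identity -/

theorem Qmu_sub {D : SpectralBasis H} (N : DiagonalNoise D) (μ : ℝ) (g h : H) :
    Qmu N μ (g - h) = Qmu N μ g - Qmu N μ h := by
  simp only [← noiseInput_apply, map_sub]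

theorem intervalIntegrable_of_mem_Icc {E : Type*} [NormedAddCommGroup E] {ψ : ℝ → E} {a b : ℝ}
    (hψ : MemLp ψ 2 (volume.restrict (Set.Ioo a b)))
    {s t : ℝ} (hs : s ∈ Set.Icc a b) (ht : t ∈ Set.Icc a b) : IntervalIntegrable ψ volume s t :=
  (intervalIntegrable_of_memLp (hs.1.trans hs.2) hψ).mono_set
    (Set.uIcc_subset_uIcc (Set.Icc_subset_uIcc hs) (Set.Icc_subset_uIcc ht))

section Action

variable [CompleteSpace H]

/-- The total forcing `Q_μ (ψ - Q DF(Π₁ z))` of the skeleton equation. -/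
def forcing {D : SpectralBasis H} (N : DiagonalNoise D) (F : H → ℝ) (μ : ℝ) (ψ : ℝ → H)
    (z : ℝ → Phase D) (s : ℝ) : Phase D :=
  Qmu N μ (ψ s - N.Q (gradient F (z s).fst))

/-- The skeleton equation on `[a, b]`, with both sides transported to time `0` by the group `S_μ`.
In this form it is additive in the time interval. -/
def IsTransported {D : SpectralBasis H} (N : DiagonalNoise D) (F : H → ℝ) {μ : ℝ} (hμ : 0 < μ)
    (a b : ℝ) (ψ : ℝ → H) (z : ℝ → Phase D) : Prop :=
  ∀ t ∈ Set.Icc a b,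
    S D hμ (-t) (z t) = S D hμ (-a) (z a) + ∫ s in a..t, S D hμ (-s) (forcing N F μ ψ z s)

variable {D : SpectralBasis H} {N : DiagonalNoise D} {F : H → ℝ} {μ : ℝ} {a b c : ℝ}
  {ψ : ℝ → H} {z : ℝ → Phase D}

theorem continuousOn_drift (hF : Continuous (gradient F)) {s : Set ℝ} (hz : ContinuousOn z s) :
    ContinuousOn (fun t => N.Q (gradient F (z t).fst)) s :=
  (N.Q.continuous.comp (hF.comp (WithLp.fstL 2 ℝ H (HMinusOne D)).continuous)).comp_continuousOn hz

theorem intervalIntegrable_drift (hF : Continuous (gradient F))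
    (hz : ContinuousOn z (Set.Icc a b)) {s t : ℝ} (hs : s ∈ Set.Icc a b) (ht : t ∈ Set.Icc a b) :
    IntervalIntegrable (fun r => N.Q (gradient F (z r).fst)) volume s t :=
  ((continuousOn_drift hF hz).mono (Set.uIcc_subset_Icc hs ht)).intervalIntegrable

theorem intervalIntegrable_forcing (hF : Continuous (gradient F))
    (hz : ContinuousOn z (Set.Icc a b)) (hψ : MemLp ψ 2 (volume.restrict (Set.Ioo a b)))
    {s t : ℝ} (hs : s ∈ Set.Icc a b) (ht : t ∈ Set.Icc a b) :
    IntervalIntegrable (forcing N F μ ψ z) volume s t :=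
  intervalIntegrable_Qmu N μ
    ((intervalIntegrable_of_mem_Icc hψ hs ht).sub (intervalIntegrable_drift hF hz hs ht))

theorem intervalIntegrable_S_forcing (hμ : 0 < μ) (hF : Continuous (gradient F))
    (hz : ContinuousOn z (Set.Icc a b)) (hψ : MemLp ψ 2 (volume.restrict (Set.Ioo a b)))
    {s t : ℝ} (hs : s ∈ Set.Icc a b) (ht : t ∈ Set.Icc a b) :
    IntervalIntegrable (fun r => S D hμ (-r) (forcing N F μ ψ z r)) volume s t :=
  intervalIntegrable_of_strongly_continuous (continuous_S_neg D hμ)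
    (intervalIntegrable_forcing hF hz hψ hs ht)

theorem exists_isSkeleton_iff (hμ : 0 < μ) (hF : Continuous (gradient F))
    (hz : ContinuousOn z (Set.Icc a b)) (hψ : MemLp ψ 2 (volume.restrict (Set.Ioo a b))) :
    (∃ z₀, IsSkeleton N F hμ a b z₀ ψ z) ↔ IsTransported N F hμ a b ψ z := by
  have key : ∀ t ∈ Set.Icc a b, ∀ z₀, S D hμ (t - a) z₀
      - (∫ s in a..t, S D hμ (t - s) (Qmu N μ (N.Q (gradient F (z s).fst))))
      + ∫ s in a..t, S D hμ (t - s) (Qmu N μ (ψ s)) =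
      S D hμ t (S D hμ (-a) z₀ + ∫ s in a..t, S D hμ (-s) (forcing N F μ ψ z s)) := by
    intro t ht z₀
    have ha : a ∈ Set.Icc a b := ⟨le_rfl, ht.1.trans ht.2⟩
    have h1 := intervalIntegrable_Qmu N μ (intervalIntegrable_of_mem_Icc hψ ha ht)
    have h2 := intervalIntegrable_Qmu N μ (intervalIntegrable_drift (N := N) hF hz ha ht)
    rw [map_add, ← integral_S_sub D hμ (intervalIntegrable_forcing hF hz hψ ha ht), ← S_add,
      ← sub_eq_add_neg, sub_add, sub_eq_add_neg, neg_sub, ← intervalIntegral.integral_sub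
        (intervalIntegrable_of_strongly_continuous (continuous_S_sub D hμ t) h1)
        (intervalIntegrable_of_strongly_continuous (continuous_S_sub D hμ t) h2)]
    simp only [forcing, Qmu_sub, map_sub]
  constructor
  · rintro ⟨z₀, hz₀⟩ t ht
    have h0 : z a = z₀ := by
      have := hz₀ a ⟨le_rfl, ht.1.trans ht.2⟩
      simpa [S_zero] using this
    rw [hz₀ t ht, key t ht, S_neg_S, h0]
  · intro h
    refine ⟨z a, fun t ht => ?_⟩
    rw [key t ht, ← h t ht, S_S_neg]

theorem IsTransported.congr {hμ : 0 < μ} {ψ' : ℝ → H} {z' : ℝ → Phase D}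
    (h : IsTransported N F hμ a b ψ z) (hψ : ∀ s ∈ Set.Ioo a b, ψ s = ψ' s)
    (hz : ∀ s ∈ Set.Icc a b, z s = z' s) : IsTransported N F hμ a b ψ' z' := by
  intro t ht
  rw [← hz t ht, ← hz a ⟨le_rfl, ht.1.trans ht.2⟩, h t ht, intervalIntegral.integral_of_le ht.1,
    intervalIntegral.integral_of_le ht.1, integral_Ioc_eq_integral_Ioo,
    integral_Ioc_eq_integral_Ioo]
  congr 1
  refine setIntegral_congr_fun measurableSet_Ioo fun s hs => ?_
  simp only [forcing]
  rw [hψ s ⟨hs.1, hs.2.trans_le ht.2⟩, hz s ⟨hs.1.le, hs.2.le.trans ht.2⟩]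

theorem IsTransported.trans {hμ : 0 < μ} (hF : Continuous (gradient F)) (hab : a ≤ b)
    (hbc : b ≤ c) (hz : ContinuousOn z (Set.Icc a c))
    (hψ : MemLp ψ 2 (volume.restrict (Set.Ioo a c)))
    (h₁ : IsTransported N F hμ a b ψ z) (h₂ : IsTransported N F hμ b c ψ z) :
    IsTransported N F hμ a c ψ z := by
  intro t ht
  rcases le_total t b with htb | hbt
  · exact h₁ t ⟨ht.1, htb⟩
  · rw [h₂ t ⟨hbt, ht.2⟩, h₁ b ⟨hab, le_rfl⟩, add_assoc,
      intervalIntegral.integral_add_adjacent_intervals]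
    · exact intervalIntegrable_S_forcing hμ hF hz hψ ⟨le_rfl, hab.trans hbc⟩ ⟨hab, hbc⟩
    · exact intervalIntegrable_S_forcing hμ hF hz hψ ⟨hab, hbc⟩ ht

theorem IsTransported.mono_left {hμ : 0 < μ} (hF : Continuous (gradient F)) (hab : a ≤ b)
    (hz : ContinuousOn z (Set.Icc a c))
    (hψ : MemLp ψ 2 (volume.restrict (Set.Ioo a c)))
    (h : IsTransported N F hμ a c ψ z) : IsTransported N F hμ b c ψ z := by
  intro t ht
  have hb : b ∈ Set.Icc a c := ⟨hab, ht.1.trans ht.2⟩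
  have ha : a ∈ Set.Icc a c := ⟨le_rfl, hab.trans hb.2⟩
  have ht' : t ∈ Set.Icc a c := ⟨hab.trans ht.1, ht.2⟩
  rw [h t ht', h b hb, add_assoc, intervalIntegral.integral_add_adjacent_intervals
    (intervalIntegrable_S_forcing hμ hF hz hψ ha hb)
    (intervalIntegrable_S_forcing hμ hF hz hψ hb ht')]

/-! ### The action functional -/

theorem action_le (hμ : 0 < μ) (hF : Continuous (gradient F))
    (hz : ContinuousOn z (Set.Icc a b)) (hψ : MemLp ψ 2 (volume.restrict (Set.Ioo a b)))
    (h : IsTransported N F hμ a b ψ z) :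
    action N F hμ a b z ≤ 1 / 2 * eLpNorm ψ 2 (volume.restrict (Set.Ioo a b)) ^ 2 := by
  refine mul_le_mul_right (iInf_le_of_le ψ (iInf₂_le_of_le hψ ?_ le_rfl)) _
  exact (exists_isSkeleton_iff hμ hF hz hψ).2 h

theorem le_action (hμ : 0 < μ) (hF : Continuous (gradient F))
    (hz : ContinuousOn z (Set.Icc a b)) {x : ℝ≥0∞}
    (h : ∀ ψ, MemLp ψ 2 (volume.restrict (Set.Ioo a b)) → IsTransported N F hμ a b ψ z →
      x ≤ 1 / 2 * eLpNorm ψ 2 (volume.restrict (Set.Ioo a b)) ^ 2) :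
    x ≤ action N F hμ a b z := by
  have h0 : (1 / 2 : ℝ≥0∞) ≠ 0 := by simp
  have h1 : (1 / 2 : ℝ≥0∞) ≠ ⊤ := by simp
  simp only [action, ENNReal.mul_iInf_of_ne h0 h1]
  exact le_iInf fun ψ => le_iInf₂ fun hψ hs => h ψ hψ ((exists_isSkeleton_iff hμ hF hz hψ).1 hs)

theorem action_congr_le (hμ : 0 < μ) (hF : Continuous (gradient F)) {z' : ℝ → Phase D}
    (hz : ContinuousOn z (Set.Icc a b)) (h : ∀ s ∈ Set.Icc a b, z s = z' s) :
    action N F hμ a b z' ≤ action N F hμ a b z :=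
  le_action hμ hF hz fun _ hψ hm =>
    action_le hμ hF (hz.congr fun s hs => (h s hs).symm) hψ (hm.congr (fun _ _ => rfl) h)

theorem action_of_eq_zero (hμ : 0 < μ) (hF : Continuous (gradient F)) (hF0 : gradient F 0 = 0)
    (h : ∀ s ∈ Set.Icc a b, z s = 0) : action N F hμ a b z = 0 := by
  have hz : ContinuousOn z (Set.Icc a b) := continuousOn_const.congr h
  have h0 : IsTransported N F hμ a b (fun _ => 0) (fun _ => (0 : Phase D)) := fun t _ => by
    have : Qmu N μ 0 = 0 := by rw [← noiseInput_apply, map_zero]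
    simp [forcing, hF0, this]
  refine le_antisymm ?_ zero_le
  simpa using action_le hμ hF hz (ψ := fun _ => 0) MemLp.zero'
    (h0.congr (fun _ _ => rfl) fun s hs => (h s hs).symm)

theorem action_mono_left (hμ : 0 < μ) (hF : Continuous (gradient F)) (hab : a ≤ b)
    (hz : ContinuousOn z (Set.Icc a c)) : action N F hμ b c z ≤ action N F hμ a c z := by
  refine le_action hμ hF hz fun ψ hψ hm => ?_
  have hsub : volume.restrict (Set.Ioo b c) ≤ volume.restrict (Set.Ioo a c) :=
    Measure.restrict_mono (Set.Ioo_subset_Ioo_left hab) le_rfl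
  refine (action_le hμ hF (hz.mono (Set.Icc_subset_Icc_left hab)) (hψ.mono_measure hsub)
    (hm.mono_left hF hab hz hψ)).trans ?_
  gcongr

theorem eLpNorm_two_sq {E X : Type*} [NormedAddCommGroup E] [MeasurableSpace X]
    (ν : Measure X) (f : X → E) : eLpNorm f 2 ν ^ 2 = ∫⁻ x, ‖f x‖ₑ ^ 2 ∂ν := by
  simpa using eLpNorm_nnreal_pow_eq_lintegral (μ := ν) (f := f) (p := 2) two_ne_zero

/-- Controls on consecutive intervals are glued by adding their indicators, and their squared
norms add up. -/
theorem action_add_adjacent (hμ : 0 < μ) (hF : Continuous (gradient F)) (hab : a ≤ b)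
    (hbc : b ≤ c) (hz : ContinuousOn z (Set.Icc a c)) :
    action N F hμ a c z ≤ action N F hμ a b z + action N F hμ b c z := by
  have hz₁ := hz.mono (Set.Icc_subset_Icc_right hbc)
  have hz₂ := hz.mono (Set.Icc_subset_Icc_left hab)
  rw [← tsub_le_iff_right]
  refine le_action hμ hF hz₁ fun ψ₁ hψ₁ hm₁ => ?_
  rw [tsub_le_iff_left, ← tsub_le_iff_right]
  refine le_action hμ hF hz₂ fun ψ₂ hψ₂ hm₂ => ?_
  rw [tsub_le_iff_left, ← mul_add]
  set ψ : ℝ → H := (Set.Ioo a b).indicator ψ₁ + (Set.Ioo b c).indicator ψ₂ with hψdef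
  have e₁ : ∀ s ∈ Set.Ioo a b, ψ₁ s = ψ s := fun s hs => by
    have : s ∉ Set.Ioo b c := fun h => lt_asymm h.1 hs.2
    simp [hψdef, hs, this]
  have e₂ : ∀ s ∈ Set.Ioo b c, ψ₂ s = ψ s := fun s hs => by
    have : s ∉ Set.Ioo a b := fun h => lt_asymm h.2 hs.1
    simp [hψdef, hs, this]
  have i₁ := (memLp_indicator_iff_restrict measurableSet_Ioo).2 hψ₁
  have i₂ := (memLp_indicator_iff_restrict measurableSet_Ioo).2 hψ₂
  have hψ : MemLp ψ 2 volume := i₁.add i₂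
  refine (action_le hμ hF hz (hψ.restrict _) ((hm₁.congr e₁ fun _ _ => rfl).trans hF hab hbc hz
    (hψ.restrict _) (hm₂.congr e₂ fun _ _ => rfl))).trans ?_
  gcongr
  calc eLpNorm ψ 2 (volume.restrict (Set.Ioo a c)) ^ 2
      ≤ eLpNorm ψ 2 volume ^ 2 := by
        gcongr
        exact Measure.restrict_le_self
    _ = ∫⁻ s, ‖(Set.Ioo a b).indicator ψ₁ s‖ₑ ^ 2 + ‖(Set.Ioo b c).indicator ψ₂ s‖ₑ ^ 2 := by
        rw [eLpNorm_two_sq]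
        refine lintegral_congr fun s => ?_
        by_cases hs : s ∈ Set.Ioo a b
        · have : s ∉ Set.Ioo b c := fun h => lt_asymm h.1 hs.2
          simp [hψdef, hs, this]
        · simp [hψdef, hs]
    _ = eLpNorm ψ₁ 2 (volume.restrict (Set.Ioo a b)) ^ 2 +
        eLpNorm ψ₂ 2 (volume.restrict (Set.Ioo b c)) ^ 2 := by
        rw [lintegral_add_left' (i₁.aestronglyMeasurable.enorm.pow_const 2), ← eLpNorm_two_sq,
          ← eLpNorm_two_sq, eLpNorm_indicator_eq_eLpNorm_restrict measurableSet_Ioo,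
          eLpNorm_indicator_eq_eLpNorm_restrict measurableSet_Ioo]

theorem measurePreserving_add_right_Ioo (a b h : ℝ) :
    MeasurePreserving (fun s => s + h) (volume.restrict (Set.Ioo a b))
      (volume.restrict (Set.Ioo (a + h) (b + h))) := by
  have := (measurePreserving_add_right (volume : Measure ℝ) h).restrict_preimage
    (measurableSet_Ioo (a := a + h) (b := b + h))
  simpa using this

theorem action_comp_add_le (hμ : 0 < μ) (hF : Continuous (gradient F)) (h : ℝ)
    (hz : ContinuousOn z (Set.Icc (a + h) (b + h))) :
    action N F hμ a b (fun s => z (s + h)) ≤ action N F hμ (a + h) (b + h) z := by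
  refine le_action hμ hF hz fun ψ hψ hm => ?_
  have hp := measurePreserving_add_right_Ioo a b h
  have hz' : ContinuousOn (fun s => z (s + h)) (Set.Icc a b) :=
    hz.comp (continuous_add_const h).continuousOn fun s hs =>
      ⟨by linarith [hs.1], by linarith [hs.2]⟩
  rw [← eLpNorm_comp_measurePreserving hψ.aestronglyMeasurable hp]
  refine action_le hμ hF hz' (hψ.comp_measurePreserving hp) fun t ht => ?_
  have ht' : t + h ∈ Set.Icc (a + h) (b + h) := ⟨by linarith [ht.1], by linarith [ht.2]⟩
  have ha' : a + h ∈ Set.Icc (a + h) (b + h) := ⟨le_rfl, ht'.1.trans ht'.2⟩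
  have h1 := congrArg (S D hμ h) (hm (t + h) ht')
  rw [map_add, ← integral_S_sub D hμ (intervalIntegrable_forcing hF hz hψ ha' ht'), ← S_add,
    ← S_add, show h + -(t + h) = -t by ring, show h + -(a + h) = -a by ring,
    ← intervalIntegral.integral_comp_add_right (fun s => S D hμ (h - s) (forcing N F μ ψ z s))] at h1
  rw [h1]
  congr 1
  refine intervalIntegral.integral_congr fun s _ => ?_
  simp [forcing]

end Action

/-! ### The quasi-potential -/

section QuasiPotential

variable [CompleteSpace H] {D : SpectralBasis H} {N : DiagonalNoise D} {F : H → ℝ} {μ : ℝ}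

theorem gradient_eq_zero_of_nonneg (hF0 : F 0 = 0) (hF : ∀ x, 0 ≤ F x) : gradient F 0 = 0 := by
  have h : IsLocalMin F 0 := Eventually.of_forall fun x => by simpa [hF0] using hF x
  rw [gradient, h.fderiv_eq_zero, map_zero]

/-- States close to `0` for the norm `|C_μ^{-1/2} ·|` are reached from `0` in unit time at small
cost: the linear control is corrected by the drift along the linear path, which is Lipschitz and
vanishes at `0`. -/
theorem exists_path_action_le (N : DiagonalNoise D) (hμ : 0 < μ) {K : ℝ≥0}
    (hF : LipschitzWith K (gradient F)) (hF0 : gradient F 0 = 0) :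
    ∃ C : ℝ≥0, ∀ w : Phase D, ∃ y : ℝ → Phase D, Continuous y ∧ y 0 = 0 ∧
      y 1 = covSqrt N hμ w ∧ action N F hμ 0 1 y ≤ C * ‖w‖ₑ ^ 2 := by
  obtain ⟨C₀, hC₀⟩ := exists_control_covSqrt N hμ one_pos
  obtain ⟨C₁, hC₁⟩ := exists_bound_of_strongly_continuous (continuous_S D hμ) (-1) 1
  set q : ℝ≥0 := ‖noiseInput N μ‖₊
  set C₂ : ℝ≥0 := C₁ * (C₁ * (q * C₀))
  set C₃ : ℝ≥0 := C₀ + ‖N.Q‖₊ * (K * C₂)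
  refine ⟨C₃ ^ 2, fun w => ?_⟩
  obtain ⟨ψ, hψc, hψb, hψ⟩ := hC₀ w
  have hgc : Continuous fun s => S D hμ (-s) (Qmu N μ (ψ s)) := by
    simp only [← noiseInput_apply]
    exact continuous_S_apply D hμ continuous_neg ((noiseInput N μ).continuous.comp hψc)
  have hgb : ∀ s ∈ Set.Icc (0 : ℝ) 1,
      ‖S D hμ (-s) (Qmu N μ (ψ s))‖ ≤ C₁ * (q * C₀) * ‖w‖ := fun s hs => by
    calc ‖S D hμ (-s) (Qmu N μ (ψ s))‖ ≤ C₁ * ‖Qmu N μ (ψ s)‖ :=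
          hC₁ _ ⟨by linarith [hs.2], by linarith [hs.1]⟩ _
      _ ≤ C₁ * (q * (C₀ * ‖w‖)) := by
          gcongr
          rw [← noiseInput_apply]
          exact ((noiseInput N μ).le_opNorm _).trans
            (mul_le_mul_of_nonneg_left (hψb s hs) (norm_nonneg _))
      _ = C₁ * (q * C₀) * ‖w‖ := by ring
  set y : ℝ → Phase D := fun t => S D hμ t (∫ s in 0..t, S D hμ (-s) (Qmu N μ (ψ s))) with hy
  have hyc : Continuous y := continuous_S_apply D hμ continuous_id
    (intervalIntegral.continuous_primitive (fun _ _ => hgc.intervalIntegrable _ _) 0)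
  have hyb : ∀ t ∈ Set.Icc (0 : ℝ) 1, ‖y t‖ ≤ C₂ * ‖w‖ := fun t ht => by
    have h1 : ‖∫ s in 0..t, S D hμ (-s) (Qmu N μ (ψ s))‖ ≤ C₁ * (q * C₀) * ‖w‖ * |t - 0| := by
      refine intervalIntegral.norm_integral_le_of_norm_le_const fun s hs => hgb s ?_
      rw [Set.uIoc_of_le ht.1] at hs
      exact ⟨hs.1.le, hs.2.trans ht.2⟩
    have h2 : C₁ * (q * C₀) * ‖w‖ * |t - 0| ≤ C₁ * (q * C₀) * ‖w‖ := by
      rw [sub_zero, abs_of_nonneg ht.1]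
      exact mul_le_of_le_one_right (by positivity) ht.2
    calc ‖y t‖ ≤ C₁ * ‖∫ s in 0..t, S D hμ (-s) (Qmu N μ (ψ s))‖ :=
          hC₁ t ⟨by linarith [ht.1], ht.2⟩ _
      _ ≤ C₁ * (C₁ * (q * C₀) * ‖w‖) := by
          gcongr
          exact h1.trans h2
      _ = C₂ * ‖w‖ := by
          simp only [C₂, NNReal.coe_mul]
          ring
  have y0 : y 0 = 0 := by simp [hy]
  set ψ' : ℝ → H := fun s => ψ s + N.Q (gradient F (y s).fst) with hψ'
  have hd : Continuous fun s => N.Q (gradient F (y s).fst) :=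
    continuousOn_univ.1 (continuousOn_drift hF.continuous hyc.continuousOn)
  have hψ'b : ∀ s ∈ Set.Icc (0 : ℝ) 1, ‖ψ' s‖ ≤ C₃ * ‖w‖ := fun s hs => by
    have h1 : ‖gradient F (y s).fst‖ ≤ K * (C₂ * ‖w‖) := by
      have := hF.norm_sub_le (y s).fst 0
      rw [hF0, sub_zero, sub_zero] at this
      exact this.trans (mul_le_mul_of_nonneg_left
        ((WithLp.norm_fst_le _ (y s)).trans (hyb s hs)) K.2)
    calc ‖ψ' s‖ ≤ C₀ * ‖w‖ + ‖N.Q‖ * (K * (C₂ * ‖w‖)) :=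
          (norm_add_le _ _).trans (add_le_add (hψb s hs)
            ((N.Q.le_opNorm _).trans (mul_le_mul_of_nonneg_left h1 (norm_nonneg _))))
      _ = C₃ * ‖w‖ := by
          simp only [C₃, NNReal.coe_add, NNReal.coe_mul, coe_nnnorm]
          ring
  refine ⟨y, hyc, y0, ?_, ?_⟩
  · rw [← hψ, controlMap, integral_S_sub D hμ]
    simp only [← noiseInput_apply]
    exact ((noiseInput N μ).continuous.comp hψc).intervalIntegrable _ _
  · have hm : IsTransported N F hμ 0 1 ψ' y := fun t _ => by
      simp only [forcing, hψ', add_sub_cancel_right, y0, map_zero, zero_add]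
      exact S_neg_S D hμ t _
    refine (action_le hμ hF.continuous hyc.continuousOn
      (memLp_of_continuousOn (hψc.add hd).continuousOn) hm).trans ?_
    have h1 := eLpNorm_le_of_bound hψ'b
    rw [sub_zero, ENNReal.ofReal_one, ENNReal.one_rpow, one_mul,
      ENNReal.ofReal_mul NNReal.zero_le_coe, ENNReal.ofReal_coe_nnreal, ofReal_norm] at h1
    calc 1 / 2 * eLpNorm ψ' 2 (volume.restrict (Set.Ioo 0 1)) ^ 2
        ≤ 1 * (C₃ * ‖w‖ₑ) ^ 2 := by
          gcongr
          simp
      _ = ((C₃ ^ 2 : ℝ≥0) : ℝ≥0∞) * ‖w‖ₑ ^ 2 := by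
          rw [one_mul, mul_pow, ENNReal.coe_pow]

/-- By translation invariance the infimum in the quasi-potential may be taken over paths on any
interval. -/
theorem quasiPotential_le_action (hμ : 0 < μ) (hF : Continuous (gradient F)) {a b : ℝ}
    (hab : a < b) {z : ℝ → Phase D} (hz : ContinuousOn z (Set.Icc a b)) (ha : z a = 0) {x : H}
    {y : HMinusOne D} (hb : z b = WithLp.toLp 2 (x, y)) :
    quasiPotential N F hμ x y ≤ action N F hμ a b z := by
  have h := action_comp_add_le (N := N) (F := F) (a := 0) (b := b - a) hμ hF a (z := z)
    (by simpa using hz)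
  rw [zero_add, sub_add_cancel] at h
  refine le_trans ?_ h
  refine iInf_le_of_le (b - a) (iInf_le_of_le (sub_pos.2 hab)
    (iInf_le_of_le (fun s => z (s + a)) (iInf_le_of_le ?_ (iInf₂_le_of_le ?_ ?_ le_rfl))))
  · exact hz.comp (continuous_add_const a).continuousOn fun s hs =>
      ⟨by linarith [hs.1], by linarith [hs.2]⟩
  · simpa using ha
  · simpa using hb

/-- Preceding a path on `[t, 0]` by a cheap path from `0` to `C_μ^{1/2} w`. -/
theorem quasiPotential_le_of_path (hμ : 0 < μ) (hF : Continuous (gradient F)) {x : H}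
    {y : HMinusOne D} {z : ℝ → Phase D} (hz : ContinuousOn z (Set.Iic 0))
    (hz0 : z 0 = WithLp.toLp 2 (x, y)) {t : ℝ} (ht : t < 0) {p : ℝ → Phase D}
    (hp : Continuous p) (hp0 : p 0 = 0) (hp1 : p 1 = z t) :
    quasiPotential N F hμ x y ≤ action N F hμ 0 1 p + actionInfty N F hμ z := by
  set p' : ℝ → Phase D := fun s => p (s + (1 - t)) with hp'
  have hp't : p' t = z t := by simp [hp', hp1]
  -- The glued path, written without a case distinction.
  set g : ℝ → Phase D := fun s => p' (min s t) + z (max s t) - z t with hg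
  have gl : ∀ s, s ≤ t → g s = p' s := fun s hs => by simp [hg, hs]
  have gr : ∀ s, t ≤ s → g s = z s := fun s hs => by simp [hg, hs, hp't]
  have hgc : ContinuousOn g (Set.Iic 0) := by
    have hp'c : Continuous p' := hp.comp (continuous_add_const _)
    have h1 : ContinuousOn (fun s => z (max s t)) (Set.Iic 0) :=
      hz.comp (by fun_prop) fun s hs => max_le hs ht.le
    exact ((hp'c.comp (by fun_prop)).continuousOn.add h1).sub continuousOn_const
  have hgc' : ∀ a, ContinuousOn g (Set.Icc a 0) := fun a => hgc.mono Set.Icc_subset_Iic_self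
  have e0 : g (t - 1) = 0 := by
    rw [gl _ (by linarith), hp']
    simp [hp0]
  refine (quasiPotential_le_action hμ hF (a := t - 1) (b := 0) (by linarith) (hgc' _) e0
    ((gr 0 ht.le).trans hz0)).trans ((action_add_adjacent hμ hF (b := t) (by linarith) ht.le
      (hgc' _)).trans (add_le_add ?_ ?_))
  · have h1 := action_congr_le (N := N) (F := F) (a := t - 1) (b := t) hμ hF (z := p') (z' := g)
      (hp.comp (continuous_add_const _)).continuousOn fun s hs => (gl s hs.2).symm
    have h2 := action_comp_add_le (N := N) (F := F) (a := t - 1) (b := t) hμ hF (1 - t) (z := p)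
      hp.continuousOn
    rw [show t - 1 + (1 - t) = 0 by ring, show t + (1 - t) = 1 by ring] at h2
    exact h1.trans h2
  · refine (action_congr_le hμ hF (z := z) (hz.mono Set.Icc_subset_Iic_self)
      fun s hs => (gr s hs.1).symm).trans ?_
    exact le_iSup₂ (f := fun (t : ℝ) (_ : t < 0) => action N F hμ t 0 z) t ht

theorem quasiPotential_le_actionInfty (hμ : 0 < μ) {K : ℝ≥0} (hF : LipschitzWith K (gradient F))
    (hF0 : gradient F 0 = 0) {x : H} {y : HMinusOne D} {z : ℝ → Phase D}
    (hz : ContinuousOn z (Set.Iic 0)) (hz0 : z 0 = WithLp.toLp 2 (x, y))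
    (hlim : Tendsto (fun t => covInvSqrtNorm N hμ (z t)) atBot (𝓝 0)) :
    quasiPotential N F hμ x y ≤ actionInfty N F hμ z := by
  obtain ⟨C, hC⟩ := exists_path_action_le N hμ hF hF0
  have key : ∀ δ : ℝ≥0∞, 0 < δ →
      quasiPotential N F hμ x y ≤ C * δ ^ 2 + actionInfty N F hμ z := fun δ hδ => by
    obtain ⟨t, htδ, ht⟩ := ((hlim.eventually (gt_mem_nhds hδ)).and (eventually_lt_atBot 0)).exists
    simp only [covInvSqrtNorm, iInf_lt_iff, exists_prop] at htδ
    obtain ⟨w, hw, hwδ⟩ := htδ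
    obtain ⟨p, hp, hp0, hp1, hpa⟩ := hC w
    refine (quasiPotential_le_of_path hμ hF.continuous hz hz0 ht hp hp0 (hp1.trans hw)).trans ?_
    gcongr
    refine hpa.trans ?_
    gcongr
  have hT : Tendsto (fun δ : ℝ≥0∞ => C * δ ^ 2 + actionInfty N F hμ z) (𝓝[>] 0)
      (𝓝 (C * 0 ^ 2 + actionInfty N F hμ z)) := by
    have : Continuous fun δ : ℝ≥0∞ => C * δ ^ 2 + actionInfty N F hμ z :=
      ((ENNReal.continuous_const_mul ENNReal.coe_ne_top).comp
        (ENNReal.continuous_pow 2)).add continuous_const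
    exact (this.tendsto 0).mono_left nhdsWithin_le_nhds
  simpa using ge_of_tendsto hT (eventually_mem_nhdsWithin.mono fun δ hδ => key δ hδ)

/-- A path from `0` on `[0, T]`, moved to `[-T, 0]` and extended by `0`, is an admissible path on
`(-∞, 0]` of no larger action. -/
theorem exists_extension (hμ : 0 < μ) (hF : Continuous (gradient F)) (hF0 : gradient F 0 = 0)
    {T : ℝ} (hT : 0 < T) {z : ℝ → Phase D} (hz : ContinuousOn z (Set.Icc 0 T)) (hz0 : z 0 = 0) :
    ∃ g : ℝ → Phase D, ContinuousOn g (Set.Iic 0) ∧ g 0 = z T ∧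
      Tendsto (fun t => covInvSqrtNorm N hμ (g t)) atBot (𝓝 0) ∧
      actionInfty N F hμ g ≤ action N F hμ 0 T z := by
  set g : ℝ → Phase D := fun s => z (max (s + T) 0) with hg
  have gl : ∀ s, s ≤ -T → g s = 0 := fun s hs => by
    rw [hg, ← hz0]
    simp [show s + T ≤ 0 by linarith]
  have gr : ∀ s, -T ≤ s → g s = z (s + T) := fun s hs => by
    simp [hg, show 0 ≤ s + T by linarith]
  have hgc : ContinuousOn g (Set.Iic 0) := by
    refine hz.comp (by fun_prop) fun s hs => ?_
    have hs : s ≤ 0 := hs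
    exact ⟨le_max_right _ _, max_le (by linarith) hT.le⟩
  have hgc' : ∀ a, ContinuousOn g (Set.Icc a 0) := fun a => hgc.mono Set.Icc_subset_Iic_self
  have hmain : action N F hμ (-T) 0 g ≤ action N F hμ 0 T z := by
    have hz' : ContinuousOn z (Set.Icc (-T + T) (0 + T)) := by simpa using hz
    have h1 := action_comp_add_le (N := N) hμ hF T hz'
    rw [neg_add_cancel, zero_add] at h1
    refine (action_congr_le hμ hF (z := fun s => z (s + T)) ?_
      fun s hs => (gr s hs.1).symm).trans h1
    exact hz.comp (continuous_add_const T).continuousOn fun s hs =>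
      ⟨by linarith [hs.1], by linarith [hs.2]⟩
  refine ⟨g, hgc, by simp [hg, hT.le], ?_, iSup₂_le fun t ht => ?_⟩
  · refine tendsto_const_nhds.congr' ((eventually_le_atBot (-T)).mono fun t ht => ?_)
    refine (nonpos_iff_eq_zero.1 (iInf₂_le_of_le 0 ?_ ?_)).symm
    · rw [gl t ht, map_zero]
    · simp
  · rcases le_total t (-T) with h | h
    · refine (action_add_adjacent hμ hF h (by linarith) (hgc' t)).trans ?_
      rw [action_of_eq_zero hμ hF hF0 fun s hs => gl s hs.2, zero_add]
      exact hmain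
    · exact (action_mono_left hμ hF h (hgc' _)).trans hmain

theorem quasiPotential_eq_iInf_actionInfty (N : DiagonalNoise D) (hμ : 0 < μ) {K : ℝ≥0}
    (hF : LipschitzWith K (gradient F)) (hF0 : gradient F 0 = 0) (x : H) (y : HMinusOne D) :
    quasiPotential N F hμ x y =
      ⨅ (z : ℝ → Phase D) (_ : ContinuousOn z (Set.Iic 0)) (_ : z 0 = WithLp.toLp 2 (x, y))
        (_ : Tendsto (fun t => covInvSqrtNorm N hμ (z t)) atBot (𝓝 0)),
        actionInfty N F hμ z := by
  refine le_antisymm ?_ ?_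
  · exact le_iInf₂ fun z hz => le_iInf₂ fun hz0 hlim =>
      quasiPotential_le_actionInfty hμ hF hF0 hz hz0 hlim
  · refine le_iInf₂ fun T hT => le_iInf₂ fun z hz => le_iInf₂ fun hz0 hzT => ?_
    obtain ⟨g, hg, hg0, hlim, ha⟩ := exists_extension (N := N) hμ hF.continuous hF0 hT hz hz0
    exact iInf₂_le_of_le g hg (iInf₂_le_of_le (hg0.trans hzT) hlim ha)

end QuasiPotential

end DampedWave

end

theorem mainTheorem1 {d : ℕ} (O : Set (EuclideanSpace ℝ (Fin d)))
    (hO : IsOpen O) (hOb : Bornology.IsBounded O)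
    (D : DampedWave.SpectralBasis (DampedWave.L2 O))
    (hD : ∀ k, DampedWave.IsDirichletEigenfunction O (D.α k) (D.e k))
    (N : DampedWave.DiagonalNoise D)
    (F : DampedWave.L2 O → ℝ) (hF : ContDiff ℝ 1 F) (hF0 : F 0 = 0) (hFnonneg : ∀ x, 0 ≤ F x)
    (hFmono : ∀ x, 0 ≤ inner ℝ (gradient F x) x)
    (κ : ℝ) (hFlip : ∀ x y, ‖gradient F x - gradient F y‖ ≤ κ * ‖x - y‖)
    (μ : ℝ) (hμ : 0 < μ) :
    (∀ (x : DampedWave.L2 O) (y : DampedWave.HMinusOne D),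
      DampedWave.quasiPotential N F hμ x y =
        ⨅ (z : ℝ → DampedWave.Phase D) (_ : ContinuousOn z (Set.Iic 0))
          (_ : z 0 = WithLp.toLp 2 (x, y))
          (_ : Tendsto (fun t => DampedWave.covInvSqrtNorm N hμ (z t)) atBot (𝓝 0)),
          DampedWave.actionInfty N F hμ z) ∧
    (∃ T : ℝ, 0 < T ∧ ∃ c : ℝ → ℝ≥0, ∀ t₁ t₂ : ℝ, t₁ < t₂ - T →
      DampedWave.controlMap N hμ t₁ t₂ '' {ψ | MemLp ψ 2 (volume.restrict (Set.Ioo t₁ t₂))} =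
          Set.range (DampedWave.covSqrt N hμ) ∧
      ∀ z ∈ DampedWave.controlMap N hμ t₁ t₂ ''
          {ψ | MemLp ψ 2 (volume.restrict (Set.Ioo t₁ t₂))},
        DampedWave.controlCost N hμ t₁ t₂ z ≤
          c (t₂ - t₁) * DampedWave.covInvSqrtNorm N hμ z) := by
  constructor
  · intro x y
    have hlip : LipschitzWith κ.toNNReal (gradient F) := LipschitzWith.of_dist_le_mul fun a b => by
      rw [dist_eq_norm, dist_eq_norm]
      exact (hFlip a b).trans
        (mul_le_mul_of_nonneg_right (Real.le_coe_toNNReal κ) (norm_nonneg _))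
    exact DampedWave.quasiPotential_eq_iInf_actionInfty N hμ hlip
      (DampedWave.gradient_eq_zero_of_nonneg hF0 hFnonneg) x y
  · -- Any positive waiting time will do, since the ramp construction works in every positive time.
    choose c hc using fun τ : {τ : ℝ // 0 < τ} => DampedWave.exists_controlCost_le N hμ τ.2
    refine ⟨1, one_pos, fun τ => if h : 0 < τ then c ⟨τ, h⟩ else 0, fun t₁ t₂ ht => ?_⟩
    have h : 0 < t₂ - t₁ := by linarith
    refine ⟨DampedWave.image_controlMap N hμ (sub_pos.1 h), fun z _ => ?_⟩
    simpa only [dif_pos h] using hc ⟨t₂ - t₁, h⟩ t₁ t₂ rfl z
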